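/- Let $\mathbb F_q$ be a finite field with $q$ elements, $k=\mathbb F_q(\theta)$ with the absolute value $|\cdot|_\infty$ at the infinite place normalized by $|\theta|_\infty=q$, $k_\infty$ the completion of $k$, $\mathbb C_\infty$ the completion of an algebraic closure of $k_\infty$ (with the unique extension of $|\cdot|_\infty$), and $\overline k$ the algebraic closure of $k$ in $\mathbb C_\infty$. Put $L_0:=1$ and $L_i:=(\theta-\theta^{q})\cdots(\theta-\theta^{q^i})$ for $i\ge 1$. For $n\geq 1$ and positive integers $a_1,\dots,a_n$ let $$\mathrm{Li}^\star_{(a_1,\dots,a_n)}(z_1,\dots,z_n):=\sum_{i_1\ge\cdots\ge i_n\ge 0}\frac{z_1^{q^{i_1}}\cdots z_n^{q^{i_n}}}{L_{i_1}^{a_1}\cdots L_{i_n}^{a_n}} .$$ Let $r\ge 1$, let $\mathfrak s=(s_1,\dots,s_r)$ be a tuple of positive integers and $\mathbf u=(u_1,\dots,u_r)\in(\overline k^{\times})^r$. Assume that the reversed tuple $\widetilde{\mathbf u}=(u_r,\dots,u_1)$ lies in $\mathbb D''_{\widetilde{\mathfrak s}}$, where $\widetilde{\mathfrak s}=(s_r,\dots,s_1)$;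 that is, $|u_r|_\infty<q^{s_rq/(q-1)}$ and $|u_i|_\infty\le q^{s_iq/(q-1)}$ for $1\le i<r$. Put $d_\ell:=s_\ell+\cdots+s_r$ and $d:=d_1+\cdots+d_r$, and divide vectors of length $d$ into consecutive blocks of lengths $d_1,\dots,d_r$, and $d\times d$ matrices accordingly. Let $N\in\mathrm{Mat}_d(\overline k)$ be the block diagonal matrix whose $\ell$-th diagonal block is the $d_\ell\times d_\ell$ matrix with $1$ on the superdiagonal and $0$ elsewhere. Let $E\in\mathrm{Mat}_d(\overline k)$ be the matrix whose block $(\ell,m)$ is $0$ for $\ell>m$ and, for $\ell\le m$, has $(-1)^{m-\ell}\prod_{\ell\le e<m}u_e$ in its lower left corner and $0$ elsewhere. Let $G=G_{\mathfrak s,\mathbf u}=(\mathbb G_a^d,\rho)$ be the $t$-module over $\overline k$ given by $\rho_t=\theta I_d+N+E\tau$, where $\tau$ is the $q$-th power Frobenius. Let $\mathbf v=\mathbf v_{\mathfrak s,\mathbf u}\in G(\overline k)$ be the point whose last coordinate in the $\ell$-th block is $(-1)^{r-\ell}u_\ell u_{\ell+1}\cdots u_r$ for $1\le\ell\le r$ and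 whose other coordinates are $0$. Let $\exp_G$ be the unique series $\sum_{i\ge 0}Q_i\tau^i$ with $Q_i\in\mathrm{Mat}_d(\overline k)$, $Q_0=I_d$ and $\rho_a\circ\exp_G=\exp_G\circ\,\partial\rho_a$ for all $a\in\mathbb F_q[t]$, where $\partial\rho_a$ is the constant coefficient of $\rho_a$, and let $\log_G=\sum_{i\ge0}P_i\tau^i$ be its formal inverse. Then the series $\log_G(\mathbf v)=\sum_{i\ge 0}P_i\mathbf v^{(i)}$ converges in $\mathbb C_\infty^d$, where $\mathbf v^{(i)}$ is obtained from $\mathbf v$ by raising the coordinates to the power $q^i$. For every $1\le\ell\le r$ the series defining $\mathrm{Li}^\star_{(s_r,\dots,s_\ell)}(u_r,\dots,u_\ell)$ converges, and the last coordinate of $\log_G(\mathbf v)$ in the $\ell$-th block, that is, its $(d_1+\cdots+d_\ell)$-th coordinate, equals $$(-1)^{r-\ell}\,\mathrm{Li}^\star_{(s_r,\dots,s_\ell)}(u_r,\dots,u_\ell).$$ In particular, the $(s_1+\cdots+s_r)$-th coordinate of $\log_G(\mathbf v)$ is $(-1)^{r-1}\mathrm{Li}^\star_{\widetilde{\mathfrak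 s}}(\widetilde{\mathbf u})$. -/

import Mathlib

noncomputable section

open scoped Polynomial Matrix

namespace CarlitzStar

open Classical in
/-- The normalized absolute value at the infinite place of `k = 𝔽_q(θ)`:
`|f| = q ^ deg f`, so that `|θ| = q`. -/
def inftyAbs (F : Type*) [Field F] [Fintype F] : AbsoluteValue (RatFunc F) ℝ :=
  { toFun := fun f => if f = 0 then 0 else (Fintype.card F : ℝ) ^ f.intDegree
    map_mul' := by
      intro x y
      have hq : (Fintype.card F : ℝ) ≠ 0 := by exact_mod_cast Fintype.card_ne_zero
      by_cases hx : x = 0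
      · simp [hx]
      by_cases hy : y = 0
      · simp [hy]
      simp [hx, hy, RatFunc.intDegree_mul hx hy, zpow_add₀ hq]
    nonneg' := by
      intro x
      change (0 : ℝ) ≤ if x = 0 then 0 else _
      split_ifs <;> positivity
    eq_zero' := by
      intro x
      have hq : (Fintype.card F : ℝ) ≠ 0 := by exact_mod_cast Fintype.card_ne_zero
      by_cases hx : x = 0
      · simp [hx]
      · simp [hx, zpow_ne_zero _ hq]
    add_le' := by
      intro x y
      have hq1 : (1 : ℝ) ≤ Fintype.card F := by exact_mod_cast Fintype.card_pos
      by_cases hx : x = 0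
      · simp [hx]
      by_cases hy : y = 0
      · simp [hy]
      by_cases hxy : x + y = 0
      · simp only [hx, hy, hxy, if_true, if_false]; positivity
      simp only [hx, hy, hxy, if_false]
      rcases le_max_iff.mp (RatFunc.intDegree_add_le hy hxy) with h | h
      · exact (zpow_le_zpow_right₀ hq1 h).trans (le_add_of_nonneg_right (by positivity))
      · exact (zpow_le_zpow_right₀ hq1 h).trans (le_add_of_nonneg_left (by positivity)) }

section Field

variable (F : Type*) [Field F] [Fintype F]

theorem inftyAbs_add_le_max (x y : RatFunc F) :
    inftyAbs F (x + y) ≤ max (inftyAbs F x) (inftyAbs F y) := by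
  classical
  have hq1 : (1 : ℝ) ≤ Fintype.card F := by exact_mod_cast Fintype.card_pos
  by_cases hx : x = 0
  · simp [hx]
  by_cases hy : y = 0
  · simp [hy]
  by_cases hxy : x + y = 0
  · rw [hxy, map_zero]
    exact le_max_of_le_left ((inftyAbs F).nonneg x)
  change (if x + y = 0 then (0 : ℝ) else _) ≤
    max (if x = 0 then (0 : ℝ) else _) (if y = 0 then (0 : ℝ) else _)
  simp only [hx, hy, hxy, if_false]
  rcases le_max_iff.mp (RatFunc.intDegree_add_le hy hxy) with h | h
  · exact le_max_of_le_left (zpow_le_zpow_right₀ hq1 h)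
  · exact le_max_of_le_right (zpow_le_zpow_right₀ hq1 h)

theorem inftyAbs_X : inftyAbs F RatFunc.X = Fintype.card F := by
  classical
  change (if (RatFunc.X : RatFunc F) = 0 then (0 : ℝ) else _) = _
  simp [RatFunc.X_ne_zero]

/-- `k_∞`, the completion of `k = 𝔽_q(θ)` at the infinite place. -/
abbrev KInfty : Type _ := (inftyAbs F).Completion

instance : IsUltrametricDist (WithAbs (inftyAbs F)) :=
  IsUltrametricDist.isUltrametricDist_of_forall_norm_add_le_max_norm
    fun x y => inftyAbs_add_le_max F x.ofAbs y.ofAbs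

instance : IsUltrametricDist (KInfty F) :=
  IsUltrametricDist.isUltrametricDist_of_forall_norm_add_le_max_norm fun x y => by
    induction x, y using UniformSpace.Completion.induction_on₂ with
    | hp => exact isClosed_le (by fun_prop) (by fun_prop)
    | ih x y =>
      rw [← UniformSpace.Completion.coe_add]
      simp only [UniformSpace.Completion.norm_coe]
      exact inftyAbs_add_le_max F x.ofAbs y.ofAbs

instance : NontriviallyNormedField (KInfty F) where
  non_trivial := ⟨((WithAbs.toAbs (inftyAbs F) RatFunc.X : WithAbs (inftyAbs F)) : KInfty F), by
    rw [UniformSpace.Completion.norm_coe, WithAbs.norm_toAbs_eq, inftyAbs_X]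
    exact_mod_cast Fintype.one_lt_card⟩

/-- The embedding of `k = 𝔽_q(θ)` into `k_∞`. -/
def toKInfty : RatFunc F →+* KInfty F :=
  UniformSpace.Completion.coeRingHom.comp (WithAbs.equiv (inftyAbs F)).symm.toRingHom

/-- A fixed algebraic closure of `k_∞`. -/
abbrev KInftyAlg : Type _ := AlgebraicClosure (KInfty F)

/-- The canonical absolute value on the algebraic closure of `k_∞`, extending that of `k_∞`. -/
instance : NormedField (KInftyAlg F) := spectralNorm.normedField (KInfty F) (KInftyAlg F)

/-- `ℂ_∞`, the completion of the algebraic closure of `k_∞`. -/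
def CInfty : Type _ := UniformSpace.Completion (KInftyAlg F)

instance : NormedField (CInfty F) :=
  inferInstanceAs (NormedField (UniformSpace.Completion (KInftyAlg F)))

instance : CompleteSpace (CInfty F) :=
  inferInstanceAs (CompleteSpace (UniformSpace.Completion (KInftyAlg F)))

/-- The embedding of `k = 𝔽_q(θ)` into `ℂ_∞`. -/
def toCInfty : RatFunc F →+* CInfty F :=
  ((UniformSpace.Completion.coeRingHom : KInftyAlg F →+* _).comp
    (algebraMap (KInfty F) (KInftyAlg F))).comp (toKInfty F)

instance : Algebra (RatFunc F) (CInfty F) := (toCInfty F).toAlgebra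

instance : Algebra F (CInfty F) := ((toCInfty F).comp (algebraMap F (RatFunc F))).toAlgebra

instance : IsScalarTower F (RatFunc F) (CInfty F) := IsScalarTower.of_algebraMap_eq fun _ => rfl

/-- `k̄`, the algebraic closure of `k = 𝔽_q(θ)` in `ℂ_∞`. -/
abbrev KBar : IntermediateField (RatFunc F) (CInfty F) := algebraicClosure (RatFunc F) (CInfty F)

end Field

section Twisted

/-- Twisted power series `∑ aₙ τⁿ` over a ring `R` with an endomorphism `φ`;
multiplication is determined by `τ a = φ(a) τ`. -/
@[ext] structure TwistedSeries {R : Type*} [Ring R] (φ : R →+* R) where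
  /-- the coefficient of `τⁿ` -/
  coeff : ℕ → R

variable {R : Type*} [Ring R] {φ : R →+* R}

namespace TwistedSeries

instance : Zero (TwistedSeries φ) := ⟨⟨fun _ => 0⟩⟩

instance : One (TwistedSeries φ) := ⟨⟨fun n => if n = 0 then 1 else 0⟩⟩

instance : Add (TwistedSeries φ) := ⟨fun f g => ⟨fun n => f.coeff n + g.coeff n⟩⟩

instance : Neg (TwistedSeries φ) := ⟨fun f => ⟨fun n => -f.coeff n⟩⟩

instance : Mul (TwistedSeries φ) :=
  ⟨fun f g => ⟨fun n =>
    ∑ p ∈ Finset.HasAntidiagonal.antidiagonal n, f.coeff p.1 * (φ ^ p.1) (g.coeff p.2)⟩⟩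

theorem coeff_zero (n : ℕ) : (0 : TwistedSeries φ).coeff n = 0 := rfl

theorem coeff_one (n : ℕ) : (1 : TwistedSeries φ).coeff n = if n = 0 then 1 else 0 := rfl

theorem coeff_add (f g : TwistedSeries φ) (n : ℕ) :
    (f + g).coeff n = f.coeff n + g.coeff n := rfl

theorem coeff_neg (f : TwistedSeries φ) (n : ℕ) : (-f).coeff n = -f.coeff n := rfl

theorem coeff_mul (f g : TwistedSeries φ) (n : ℕ) : (f * g).coeff n =
    ∑ p ∈ Finset.HasAntidiagonal.antidiagonal n, f.coeff p.1 * (φ ^ p.1) (g.coeff p.2) := rfl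

instance : Ring (TwistedSeries φ) :=
  Ring.ofMinimalAxioms
    (fun f g h => by
      ext n
      simp only [coeff_add, add_assoc])
    (fun f => by
      ext n
      simp only [coeff_add, coeff_zero, zero_add])
    (fun f => by
      ext n
      simp only [coeff_add, coeff_neg, coeff_zero, neg_add_cancel])
    (fun f g h => by
      ext n
      simp only [coeff_mul, Finset.sum_mul, map_sum, Finset.mul_sum, map_mul]
      rw [Finset.sum_sigma', Finset.sum_sigma']
      refine Finset.sum_nbij' (fun x => ⟨(x.2.1, x.2.2 + x.1.2), (x.2.2, x.1.2)⟩)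
        (fun x => ⟨(x.1.1 + x.2.1, x.2.2), (x.1.1, x.2.1)⟩) ?_ ?_ ?_ ?_ ?_
      · rintro ⟨⟨a, b⟩, c, d⟩ hx
        simp only [Finset.mem_sigma, Finset.HasAntidiagonal.mem_antidiagonal] at hx ⊢
        exact ⟨by omega, trivial⟩
      · rintro ⟨⟨a, b⟩, c, d⟩ hx
        simp only [Finset.mem_sigma, Finset.HasAntidiagonal.mem_antidiagonal] at hx ⊢
        exact ⟨by omega, trivial⟩
      · rintro ⟨⟨a, b⟩, c, d⟩ hx
        simp only [Finset.mem_sigma, Finset.HasAntidiagonal.mem_antidiagonal] at hx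
        obtain ⟨h1, h2⟩ := hx
        subst h2
        rfl
      · rintro ⟨⟨a, b⟩, c, d⟩ hx
        simp only [Finset.mem_sigma, Finset.HasAntidiagonal.mem_antidiagonal] at hx
        obtain ⟨h1, h2⟩ := hx
        subst h2
        rfl
      · rintro ⟨⟨a, b⟩, c, d⟩ hx
        simp only [Finset.mem_sigma, Finset.HasAntidiagonal.mem_antidiagonal] at hx
        obtain ⟨h1, h2⟩ := hx
        subst h2
        simp only [pow_add, RingHom.mul_def, RingHom.comp_apply, mul_assoc])
    (fun f => by
      ext n
      rw [coeff_mul, Finset.sum_eq_single (0, n)]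
      · simp [coeff_one]
      · rintro ⟨a, b⟩ hab hne
        have : a ≠ 0 := by
          rintro rfl
          simp_all
        simp [coeff_one, this]
      · simp)
    (fun f => by
      ext n
      rw [coeff_mul, Finset.sum_eq_single (n, 0)]
      · simp [coeff_one]
      · rintro ⟨a, b⟩ hab hne
        have : b ≠ 0 := by
          rintro rfl
          simp_all
        simp [coeff_one, this]
      · simp)
    (fun f g h => by
      ext n
      simp only [coeff_mul, coeff_add, map_add, mul_add, Finset.sum_add_distrib])
    (fun f g h => by
      ext n
      simp only [coeff_mul, coeff_add, add_mul, Finset.sum_add_distrib])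

/-- The constant series `a τ⁰`. -/
def const (φ : R →+* R) : R →+* TwistedSeries φ where
  toFun a := ⟨fun n => if n = 0 then a else 0⟩
  map_one' := rfl
  map_zero' := by
    ext n
    simp [coeff_zero]
  map_add' a b := by
    ext n
    by_cases h : n = 0 <;> simp [coeff_add, h]
  map_mul' a b := by
    ext n
    rw [coeff_mul]
    by_cases h : n = 0
    · simp [h]
    · simp only [if_neg h]
      refine (Finset.sum_eq_zero ?_).symm
      rintro ⟨i, j⟩ hij
      simp only [Finset.HasAntidiagonal.mem_antidiagonal] at hij
      by_cases hi : i = 0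
      · have hj : j ≠ 0 := by omega
        simp [hj]
      · simp [hi]

theorem coeff_const (a : R) (n : ℕ) : (const φ a).coeff n = if n = 0 then a else 0 := rfl

theorem coeff_const_mul (a : R) (f : TwistedSeries φ) (n : ℕ) :
    (const φ a * f).coeff n = a * f.coeff n := by
  rw [coeff_mul, Finset.sum_eq_single (0, n)]
  · simp [coeff_const]
  · rintro ⟨i, j⟩ hab hne
    have : i ≠ 0 := by
      rintro rfl
      simp_all
    simp [coeff_const, this]
  · simp

theorem coeff_mul_const (a : R) (f : TwistedSeries φ) (n : ℕ) :
    (f * const φ a).coeff n = f.coeff n * (φ ^ n) a := by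
  rw [coeff_mul, Finset.sum_eq_single (n, 0)]
  · simp [coeff_const]
  · rintro ⟨i, j⟩ hab hne
    have : j ≠ 0 := by
      rintro rfl
      simp_all
    simp [coeff_const, this]
  · simp

/-- The constant coefficient, as a ring homomorphism. -/
def coeffZero (φ : R →+* R) : TwistedSeries φ →+* R where
  toFun f := f.coeff 0
  map_one' := rfl
  map_zero' := rfl
  map_add' _ _ := rfl
  map_mul' f g := by simp [coeff_mul]

/-- The coefficients of a left inverse of a series with constant coefficient `1`. -/
def invAux (f : TwistedSeries φ) : ℕ → R
  | n => (if n = 0 then 1 else 0) -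
      ∑ i : Fin n, invAux f i * (φ ^ (i : ℕ)) (f.coeff (n - i))

theorem exists_left_inverse (f : TwistedSeries φ) (hf : f.coeff 0 = 1) :
    ∃ g : TwistedSeries φ, g * f = 1 := by
  refine ⟨⟨invAux f⟩, ?_⟩
  ext n
  rw [coeff_mul, coeff_one, Finset.Nat.sum_antidiagonal_eq_sum_range_succ_mk,
    Finset.sum_range_succ]
  simp only [Nat.sub_self, hf, map_one, mul_one]
  rw [Finset.sum_range (fun i => invAux f i * (φ ^ i) (f.coeff (n - i)))]
  conv_lhs =>
    arg 2
    rw [invAux]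
  rw [add_sub_cancel]

theorem isUnit_of_coeff_zero_eq_one (f : TwistedSeries φ) (hf : f.coeff 0 = 1) : IsUnit f := by
  obtain ⟨g, hg⟩ := exists_left_inverse f hf
  have hg0 : g.coeff 0 = 1 := by
    have := congrArg (coeffZero φ) hg
    rw [map_mul, map_one] at this
    change g.coeff 0 * f.coeff 0 = 1 at this
    rwa [hf, mul_one] at this
  obtain ⟨h, hh⟩ := exists_left_inverse g hg0
  have : h = f := by
    calc h = h * (g * f) := by rw [hg, mul_one]
      _ = f := by rw [← mul_assoc, hh, one_mul]
  subst this
  exact ⟨⟨h, g, hh, hg⟩, rfl⟩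

end TwistedSeries

/-- Twisted polynomials: the twisted power series with finitely many nonzero coefficients. -/
def twistedPolynomials (φ : R →+* R) : Subring (TwistedSeries φ) where
  carrier := {f | ∃ N, ∀ n, N ≤ n → f.coeff n = 0}
  one_mem' := ⟨1, fun n hn => by rw [TwistedSeries.coeff_one, if_neg (by omega)]⟩
  zero_mem' := ⟨0, fun _ _ => rfl⟩
  add_mem' := by
    rintro f g ⟨N, hN⟩ ⟨M, hM⟩
    refine ⟨max N M, fun n hn => ?_⟩
    rw [TwistedSeries.coeff_add, hN n (le_of_max_le_left hn), hM n (le_of_max_le_right hn),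
      add_zero]
  neg_mem' := by
    rintro f ⟨N, hN⟩
    exact ⟨N, fun n hn => by rw [TwistedSeries.coeff_neg, hN n hn, neg_zero]⟩
  mul_mem' := by
    rintro f g ⟨N, hN⟩ ⟨M, hM⟩
    refine ⟨N + M, fun n hn => ?_⟩
    rw [TwistedSeries.coeff_mul]
    refine Finset.sum_eq_zero ?_
    rintro ⟨i, j⟩ hij
    simp only [Finset.HasAntidiagonal.mem_antidiagonal] at hij
    rcases le_or_gt N i with h | h
    · simp [hN i h]
    · simp [hM j (by omega)]

theorem const_mem_twistedPolynomials (a : R) : TwistedSeries.const φ a ∈ twistedPolynomials φ :=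
  ⟨1, fun n hn => by rw [TwistedSeries.coeff_const, if_neg (by omega)]⟩

end Twisted

section Frobenius

variable (F : Type*) [Field F] [Fintype F] (L : Type*) [Field L] [Algebra F L]
  (ι : Type*) [Fintype ι] [DecidableEq ι]

/-- The Frobenius twist `M ↦ M⁽¹⁾`, raising the entries of a matrix to the `q`-th power. -/
def matFrob : Matrix ι ι L →+* Matrix ι ι L :=
  (FiniteField.frobeniusAlgHom F L).toRingHom.mapMatrix

/-- The ring `Mat(L)[[τ]]` of twisted power series with matrix coefficients. -/
abbrev MatSeries : Type _ := TwistedSeries (matFrob F L ι)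

/-- The ring `Mat(L[τ])` of twisted polynomials with matrix coefficients. -/
abbrev MatPoly : Subring (MatSeries F L ι) := twistedPolynomials (matFrob F L ι)

variable {F L ι}

theorem matFrob_apply (M : Matrix ι ι L) (i j : ι) :
    matFrob F L ι M i j = M i j ^ Fintype.card F := rfl

theorem matFrob_pow_apply (n : ℕ) (M : Matrix ι ι L) (i j : ι) :
    (matFrob F L ι ^ n) M i j = M i j ^ Fintype.card F ^ n := by
  induction n generalizing M with
  | zero => simp
  | succ n ih =>
    rw [pow_succ, RingHom.mul_def, RingHom.comp_apply, ih, matFrob_apply, ← pow_mul, pow_succ,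
      mul_comm]

theorem matFrob_pow_scalar (n : ℕ) (c : L) :
    (matFrob F L ι ^ n) (Matrix.scalar ι c) = Matrix.scalar ι (c ^ Fintype.card F ^ n) := by
  ext i j
  rw [matFrob_pow_apply]
  by_cases h : i = j
  · simp [h]
  · simp [h]

theorem const_scalar_commute (c : F) (f : MatSeries F L ι) :
    Commute (TwistedSeries.const _ (Matrix.scalar ι (algebraMap F L c))) f := by
  ext n : 2
  rw [TwistedSeries.coeff_const_mul, TwistedSeries.coeff_mul_const, matFrob_pow_scalar,
    ← map_pow, FiniteField.pow_card_pow]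
  exact (Matrix.scalar_commute _ (fun r => Commute.all _ r) _).eq

end Frobenius

section TModule

/-- The element `θ` of a field extension `L` of `k = 𝔽_q(θ)`. -/
def theta (F : Type*) [Field F] (L : Type*) [Field L] [Algebra (RatFunc F) L] : L :=
  algebraMap (RatFunc F) L RatFunc.X

theorem theta_pow_ne {F : Type*} [Field F] [Fintype F] {L : Type*} [Field L]
    [Algebra (RatFunc F) L] (n : ℕ) (hn : n ≠ 0) :
    theta F L ^ Fintype.card F ^ n ≠ theta F L := by
  intro h
  unfold theta at h
  rw [← map_pow] at h
  have h2 := (algebraMap (RatFunc F) L).injective h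
  rw [← RatFunc.algebraMap_X, ← map_pow] at h2
  have h3 := congrArg Polynomial.natDegree (RatFunc.algebraMap_injective F h2)
  rw [Polynomial.natDegree_X_pow, Polynomial.natDegree_X] at h3
  exact (Nat.one_lt_pow hn Fintype.one_lt_card).ne' h3

/-- A `t`-module `(𝔾_a^ι, ρ)` over a field extension `L` of `k = 𝔽_q(θ)`: an `𝔽_q`-linear ring
homomorphism `ρ : 𝔽_q[t] → Mat(L[τ])` such that `∂ρ_t - θ I` is nilpotent. -/
structure TModule (F : Type*) [Field F] [Fintype F] (L : Type*) [Field L] [Algebra F L]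
    [Algebra (RatFunc F) L] (ι : Type*) [Fintype ι] [DecidableEq ι] where
  /-- the action of `𝔽_q[t]` -/
  ρ : F[X] →+* MatPoly F L ι
  ρ_C : ∀ c : F, (ρ (Polynomial.C c) : MatSeries F L ι) =
    TwistedSeries.const _ (Matrix.scalar ι (algebraMap F L c))
  isNilpotent : IsNilpotent
    ((ρ Polynomial.X : MatSeries F L ι).coeff 0 - Matrix.scalar ι (theta F L))

variable {F : Type*} [Field F] [Fintype F] {L : Type*} [Field L] [Algebra F L]
  [Algebra (RatFunc F) L] {ι : Type*} [Fintype ι] [DecidableEq ι]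

namespace TModule

/-- The `t`-module with a prescribed value of `ρ_t`. -/
def ofRhoT (f : MatPoly F L ι)
    (hf : IsNilpotent ((f : MatSeries F L ι).coeff 0 - Matrix.scalar ι (theta F L))) :
    TModule F L ι where
  ρ := Polynomial.eval₂RingHom'
    (((TwistedSeries.const (matFrob F L ι)).comp
      ((Matrix.scalar ι).comp (algebraMap F L))).codRestrict (MatPoly F L ι)
        fun _ => const_mem_twistedPolynomials _) f
    fun c => Subtype.ext (const_scalar_commute c (f : MatSeries F L ι))
  ρ_C c := by simp [Polynomial.eval₂RingHom']
  isNilpotent := by simpa [Polynomial.eval₂RingHom'] using hf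

theorem ofRhoT_ρ_X (f : MatPoly F L ι)
    (hf : IsNilpotent ((f : MatSeries F L ι).coeff 0 - Matrix.scalar ι (theta F L))) :
    (ofRhoT f hf).ρ Polynomial.X = f := by
  simp [ofRhoT, Polynomial.eval₂RingHom']

variable (G : TModule F L ι)

/-- `∂ρ_a`, the constant coefficient of `ρ_a`. -/
def dRho (a : F[X]) : Matrix ι ι L := (G.ρ a : MatSeries F L ι).coeff 0

/-- The defining properties of the exponential series of `G`: its linear term is the identity and
`ρ_a ∘ exp = exp ∘ ∂ρ_a` for all `a ∈ 𝔽_q[t]`. -/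
def IsExp (e : MatSeries F L ι) : Prop :=
  e.coeff 0 = 1 ∧
    ∀ a : F[X], (G.ρ a : MatSeries F L ι) * e = e * TwistedSeries.const _ (G.dRho a)

/-- The operator `Q ↦ Q (∂ρ_t)⁽ⁿ⁾ - (∂ρ_t) Q`. -/
def sylvester (n : ℕ) : Module.End L (Matrix ι ι L) :=
  LinearMap.mulRight L ((matFrob F L ι ^ n) (G.dRho Polynomial.X)) -
    LinearMap.mulLeft L (G.dRho Polynomial.X)

theorem isUnit_sylvester (n : ℕ) (hn : n ≠ 0) : IsUnit (G.sylvester n) := by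
  set N := G.dRho Polynomial.X - Matrix.scalar ι (theta F L) with hN
  have hnil : IsNilpotent N := G.isNilpotent
  have hd : G.dRho Polynomial.X = Matrix.scalar ι (theta F L) + N := by rw [hN]; abel
  set c : L := theta F L ^ Fintype.card F ^ n - theta F L with hc
  have hc0 : c ≠ 0 := sub_ne_zero.mpr (theta_pow_ne n hn)
  have key : G.sylvester n = algebraMap L (Module.End L (Matrix ι ι L)) c +
      (LinearMap.mulRight L ((matFrob F L ι ^ n) N) - LinearMap.mulLeft L N) := by
    refine LinearMap.ext fun Q => ?_
    have h1 : ∀ d : L, Matrix.scalar ι d * Q = d • Q := fun d => by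
      rw [Matrix.scalar_apply, ← Matrix.smul_eq_diagonal_mul]
    have h2 : ∀ d : L, Q * Matrix.scalar ι d = d • Q := fun d => by
      rw [← h1 d, (Matrix.scalar_commute d (fun r => Commute.all _ r) Q).eq]
    simp only [sylvester, hd, map_add, matFrob_pow_scalar, LinearMap.sub_apply, LinearMap.add_apply,
      LinearMap.mulRight_apply, LinearMap.mulLeft_apply, Module.algebraMap_end_apply, mul_add,
      add_mul, hc, sub_smul, h1, h2]
    abel
  have hnil2 : IsNilpotent
      (LinearMap.mulRight L ((matFrob F L ι ^ n) N) - LinearMap.mulLeft L N) := by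
    refine Commute.isNilpotent_sub ?_ ?_ ?_
    · exact (LinearMap.commute_mulLeft_right _ _).symm
    · exact (LinearMap.isNilpotent_mulRight_iff L _).mpr (hnil.map _)
    · exact (LinearMap.isNilpotent_mulLeft_iff L _).mpr hnil
  rw [key]
  refine IsNilpotent.isUnit_add_left_of_commute hnil2 ?_ (Algebra.commutes _ _).symm
  exact (IsUnit.mk0 c hc0).map (algebraMap L (Module.End L (Matrix ι ι L)))

/-- The functional equation for `a = t`, read off coefficientwise. -/
theorem comm_X_iff (e : MatSeries F L ι) :
    (G.ρ Polynomial.X : MatSeries F L ι) * e =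
        e * TwistedSeries.const _ (G.dRho Polynomial.X) ↔
      ∀ n, G.sylvester n (e.coeff n) = ∑ i : Fin n,
        (G.ρ Polynomial.X : MatSeries F L ι).coeff (n - i) *
          (matFrob F L ι ^ (n - i : ℕ)) (e.coeff i) := by
  rw [TwistedSeries.ext_iff, funext_iff]
  refine forall_congr' fun n => ?_
  rw [TwistedSeries.coeff_mul_const, TwistedSeries.coeff_mul,
    Finset.Nat.sum_antidiagonal_eq_sum_range_succ_mk, ← Finset.sum_range_reflect,
    Finset.sum_range_succ, Finset.sum_range]
  simp only [sylvester, LinearMap.sub_apply, LinearMap.mulRight_apply, LinearMap.mulLeft_apply]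
  have h : ∀ i : Fin n, n - (n + 1 - 1 - (i : ℕ)) = i := fun i => by omega
  simp only [h]
  simp only [Nat.succ_eq_add_one, Nat.add_sub_cancel, Nat.sub_self, pow_zero, Nat.sub_zero, dRho]
  rw [sub_eq_iff_eq_add, eq_comm]
  rfl

/-- The coefficients of the exponential series. -/
def expAux : ℕ → Matrix ι ι L
  | 0 => 1
  | n + 1 => ((G.isUnit_sylvester (n + 1) n.succ_ne_zero).unit⁻¹ : (Module.End L _)ˣ).val
      (∑ i : Fin (n + 1), (G.ρ Polynomial.X : MatSeries F L ι).coeff (n + 1 - i) *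
        (matFrob F L ι ^ (n + 1 - i : ℕ)) (expAux i))

theorem expAux_zero : G.expAux 0 = 1 := by
  rw [expAux]

theorem expAux_succ (n : ℕ) : G.expAux (n + 1) =
    ((G.isUnit_sylvester (n + 1) n.succ_ne_zero).unit⁻¹ : (Module.End L _)ˣ).val
      (∑ i : Fin (n + 1), (G.ρ Polynomial.X : MatSeries F L ι).coeff (n + 1 - i) *
        (matFrob F L ι ^ (n + 1 - i : ℕ)) (G.expAux i)) := by
  rw [expAux]

theorem dRho_mul (a b : F[X]) : G.dRho (a * b) = G.dRho a * G.dRho b := by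
  have := map_mul (TwistedSeries.coeffZero (matFrob F L ι)) (G.ρ a : MatSeries F L ι) (G.ρ b)
  rw [← Subring.coe_mul, ← map_mul] at this
  exact this

/-- Every `t`-module has exactly one exponential series. -/
theorem existsUnique_isExp : ∃! e : MatSeries F L ι, G.IsExp e := by
  refine ⟨⟨G.expAux⟩, ⟨G.expAux_zero, ?_⟩, ?_⟩
  · have hX : (G.ρ Polynomial.X : MatSeries F L ι) * ⟨G.expAux⟩ =
        ⟨G.expAux⟩ * TwistedSeries.const _ (G.dRho Polynomial.X) := by
      rw [comm_X_iff]
      rintro (_ | n)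
      · simp [sylvester, expAux_zero]
      · change G.sylvester (n + 1) (G.expAux (n + 1)) = _
        rw [expAux_succ, ← Module.End.mul_apply, IsUnit.mul_val_inv, Module.End.one_apply]
    intro a
    induction a using Polynomial.induction_on with
    | C c =>
      have h : G.dRho (Polynomial.C c) = Matrix.scalar ι (algebraMap F L c) := by
        rw [dRho, G.ρ_C, TwistedSeries.coeff_const, if_pos rfl]
      rw [h, G.ρ_C]
      exact (const_scalar_commute c _).eq
    | add p q hp hq =>
      have h : G.dRho (p + q) = G.dRho p + G.dRho q := by simp [dRho, TwistedSeries.coeff_add]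
      rw [h, map_add, map_add, Subring.coe_add, add_mul, mul_add, hp, hq]
    | monomial n c ih =>
      rw [pow_succ, ← mul_assoc, dRho_mul, map_mul, Subring.coe_mul, mul_assoc, hX,
        ← mul_assoc, ih, mul_assoc, ← map_mul]
  · rintro e ⟨he0, he⟩
    have h := (G.comm_X_iff e).mp (he _)
    ext n : 2
    induction n using Nat.strong_induction_on with
    | _ n ih =>
      rcases n with _ | n
      · exact he0.trans G.expAux_zero.symm
      · have h1 := h (n + 1)
        have h2 : ∀ i : Fin (n + 1), e.coeff i = G.expAux i := fun i => ih i i.2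
        simp only [h2] at h1
        change e.coeff (n + 1) = G.expAux (n + 1)
        rw [expAux_succ, ← h1, ← Module.End.mul_apply, IsUnit.val_inv_mul, Module.End.one_apply]

/-- The exponential series `exp_G` of a `t`-module. -/
def exp : MatSeries F L ι := G.existsUnique_isExp.choose

theorem isExp_exp : G.IsExp G.exp := G.existsUnique_isExp.choose_spec.1

theorem isUnit_exp : IsUnit G.exp :=
  TwistedSeries.isUnit_of_coeff_zero_eq_one _ G.isExp_exp.1

/-- The logarithm `log_G = ∑ Pₙ τⁿ` of a `t`-module: the formal inverse of `exp_G`. -/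
def log : MatSeries F L ι := (G.isUnit_exp.unit⁻¹ : (MatSeries F L ι)ˣ)

/-- The `n`-th term `Pₙ x⁽ⁿ⁾` of the series `log_G(x)`, at a point `x` with coordinates in an
extension `K` of `L`. -/
def logTerm {K : Type*} [Field K] [Algebra L K] (x : ι → K) (n : ℕ) : ι → K :=
  (G.log.coeff n).map (algebraMap L K) *ᵥ fun i => x i ^ Fintype.card F ^ n

end TModule
end TModule
section Construction

/-- `d_ℓ = s_ℓ + ⋯ + s_r`. -/
def blockSize {r : ℕ} (s : Fin r → ℕ) (ℓ : Fin r) : ℕ := ∑ i ∈ Finset.Ici ℓ, s i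

/-- The index set of `d`-dimensional vectors, `d = d_1 + ⋯ + d_r`, divided into `r` consecutive
blocks, the `ℓ`-th one of size `d_ℓ`. -/
abbrev BlockIndex {r : ℕ} (s : Fin r → ℕ) : Type := Σ ℓ : Fin r, Fin (blockSize s ℓ)

/-- The position of an index in the list `1, …, d_1 + ⋯ + d_r` of all coordinates, the blocks being
put one after the other: the `j`-th entry of block `ℓ` is at position `d_1 + ⋯ + d_{ℓ-1} + j`. -/
def position {r : ℕ} {s : Fin r → ℕ} (x : BlockIndex s) : ℕ := (finSigmaFinEquiv x : ℕ) + 1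

/-- An index is the last one of its block. -/
def IsBlockEnd {r : ℕ} {s : Fin r → ℕ} (x : BlockIndex s) : Prop :=
  (x.2 : ℕ) + 1 = blockSize s x.1

variable {L : Type*} [Field L] {r : ℕ}

/-- The block diagonal matrix `N`; its `ℓ`-th diagonal block is the `d_ℓ × d_ℓ` matrix with `1`s
on the superdiagonal and `0`s elsewhere. -/
def matN (L : Type*) [Field L] {r : ℕ} (s : Fin r → ℕ) :
    Matrix (BlockIndex s) (BlockIndex s) L :=
  Matrix.blockDiagonal' fun _ => Matrix.of fun i j => if (j : ℕ) = i + 1 then 1 else 0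

open Classical in
/-- The matrix `E`: its block `(ℓ, m)` is zero for `ℓ > m`; for `ℓ ≤ m` its only nonzero entry is
the one in the lower left corner, which is `(-1)^(m-ℓ) u_ℓ ⋯ u_{m-1}`. -/
def matE (s : Fin r → ℕ) (u : Fin r → L) : Matrix (BlockIndex s) (BlockIndex s) L :=
  Matrix.of fun x y =>
    if x.1 ≤ y.1 ∧ IsBlockEnd x ∧ (y.2 : ℕ) = 0 then
      (-1) ^ ((y.1 : ℕ) - x.1) * ∏ e ∈ Finset.Ico x.1 y.1, u e
    else 0

open Classical in
/-- The special point `v`: the last coordinate of the `ℓ`-th block is `(-1)^(r-ℓ) u_ℓ ⋯ u_r`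
(with `ℓ` counted from `1`), the other coordinates are zero. -/
def specialPoint (s : Fin r → ℕ) (u : Fin r → L) : BlockIndex s → L := fun x =>
  if IsBlockEnd x then (-1) ^ (r - ((x.1 : ℕ) + 1)) * ∏ e ∈ Finset.Ici x.1, u e else 0

theorem isNilpotent_matN (s : Fin r → ℕ) : IsNilpotent (matN L s) := by
  refine ⟨∑ ℓ, blockSize s ℓ, ?_⟩
  have key : ∀ (n k : ℕ), (Matrix.of fun i j : Fin n => if (j : ℕ) = i + 1 then (1 : L) else 0) ^ k
      = Matrix.of fun i j : Fin n => if (j : ℕ) = i + k then (1 : L) else 0 := by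
    intro n k
    induction k with
    | zero =>
      ext i j
      simp [Matrix.one_apply, Fin.ext_iff, eq_comm]
    | succ k ih =>
      ext i j
      rw [pow_succ, ih, Matrix.mul_apply]
      simp only [Matrix.of_apply, ite_mul, one_mul, zero_mul]
      by_cases h : (j : ℕ) = i + (k + 1)
      · have hik : (i : ℕ) + k < n := by omega
        rw [Finset.sum_eq_single ⟨i + k, hik⟩]
        · simp [h, add_assoc]
        · intro b _ hb
          rw [if_neg]
          intro hb'
          exact hb (Fin.ext hb')
        · simp
      · rw [if_neg h]
        refine Finset.sum_eq_zero fun b _ => ?_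
        split_ifs <;> first | rfl | omega
  rw [matN, ← Matrix.blockDiagonal'_pow]
  ext x y
  rw [Matrix.blockDiagonal'_apply]
  split_ifs with h
  · rw [Pi.pow_apply, key, Matrix.of_apply, if_neg, Matrix.zero_apply]
    have h1 := Finset.single_le_sum (f := blockSize s) (fun _ _ => Nat.zero_le _)
      (Finset.mem_univ x.1)
    have h2 := (cast (congrArg (fun k => Fin (blockSize s k)) h.symm) y.2).isLt
    intro h3
    omega
  · rfl

variable (F : Type*) [Field F] [Fintype F] [Algebra F L] [Algebra (RatFunc F) L]

/-- `ρ_t = θ I + N + E τ` -/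
def rhoT (s : Fin r → ℕ) (u : Fin r → L) : MatPoly F L (BlockIndex s) :=
  ⟨⟨fun n => if n = 0 then Matrix.scalar _ (theta F L) + matN L s
      else if n = 1 then matE s u else 0⟩,
    2, fun n hn => by
      change (if n = 0 then _ else if n = 1 then _ else _) = _
      rw [if_neg (by omega), if_neg (by omega)]⟩

/-- The `t`-module `G_{s,u} = (𝔾_a^d, ρ)` with `ρ_t = θ I + N + E τ`. -/
def tModule (s : Fin r → ℕ) (u : Fin r → L) : TModule F L (BlockIndex s) :=
  TModule.ofRhoT (rhoT F s u) (by simpa [rhoT] using isNilpotent_matN s)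

end Construction

section Polylog

variable (F : Type*) [Field F] [Fintype F]

/-- `L_i = (θ - θ^q) ⋯ (θ - θ^{q^i})` in `ℂ_∞`, with `L_0 = 1`. -/
def carlitzL (i : ℕ) : CInfty F :=
  ∏ j ∈ Finset.Icc 1 i, (theta F (CInfty F) - theta F (CInfty F) ^ Fintype.card F ^ j)

/-- The general term `z_1^{q^{i_1}} ⋯ z_r^{q^{i_r}} / (L_{i_1}^{s_1} ⋯ L_{i_r}^{s_r})`. -/
def polylogTerm {r : ℕ} (s : Fin r → ℕ) (z : Fin r → CInfty F) (i : Fin r → ℕ) : CInfty F :=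
  (∏ j, z j ^ Fintype.card F ^ i j) / ∏ j, carlitzL F (i j) ^ s j

/-- The Carlitz multiple star polylogarithm `Li*_s(z_1, …, z_r)`, the sum of the general terms over
`i_1 ≥ ⋯ ≥ i_r ≥ 0`. -/
def starPolylog {r : ℕ} (s : Fin r → ℕ) (z : Fin r → CInfty F) : CInfty F :=
  ∑' i : {i : Fin r → ℕ // Antitone i}, polylogTerm F s z i

/-- The series defining `Li*_s(z)` converges. -/
def StarPolylogConverges {r : ℕ} (s : Fin r → ℕ) (z : Fin r → CInfty F) : Prop :=
  Summable fun i : {i : Fin r → ℕ // Antitone i} => polylogTerm F s z i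

/-- The domain `𝔻''_s`: `|x_1| < q^{s_1 q/(q-1)}` and `|x_i| ≤ q^{s_i q/(q-1)}` for `i ≥ 2`. -/
def polylogDomain {r : ℕ} (s : Fin r → ℕ) : Set (Fin r → CInfty F) :=
  {x | ∀ i : Fin r,
    ((i : ℕ) = 0 → ‖x i‖ < (Fintype.card F : ℝ) ^
      ((s i * Fintype.card F : ℝ) / (Fintype.card F - 1))) ∧
    ((i : ℕ) ≠ 0 → ‖x i‖ ≤ (Fintype.card F : ℝ) ^
      ((s i * Fintype.card F : ℝ) / (Fintype.card F - 1)))}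

/-- The reversed tail `(a_r, …, a_ℓ)` of a tuple `(a_1, …, a_r)`. (In terms of the indices
`0, …, r-1`, its entry at `j` is the one of `a` at `r - 1 - j`.) -/
def revTail {α : Type*} {r : ℕ} (a : Fin r → α) (ℓ : Fin r) : Fin (r - ℓ) → α :=
  fun j => a (Fin.rev (Fin.castLE (Nat.sub_le r ℓ) j))

end Polylog

end CarlitzStar

end

/-!
Write `D_n = θ - θ^{q^n}` and let `N`, `E` be the matrices with `ρ_t = θ + N + E τ`. The identity
`log_G ∘ ρ_t = ∂ρ_t ∘ log_G` says (`shiftMatrix_mul_log_coeff`)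
`(D_{n+1} + N) P_{n+1} = P_{n+1} N + P_n E⁽ⁿ⁾`.
Since `N` shifts columns within a block and `E` has nonzero entries only in the lower left corners of
its blocks, this can be solved along the columns of a block: if `p_{n,m}` is the column of `P_n` at
the end of block `m` and `w_{n,m}` the column of `P_n E⁽ⁿ⁾` at the beginning of block `m`, then
`(D_{n+1} + N)^{d_m} p_{n+1,m} = w_{n,m}`, while the shape of `E` gives
`w_{n,m+1} = p_{n,m+1} - u_m^{q^n} w_{n,m}` and `P_n v⁽ⁿ⁾ = u_r^{q^n} w_{n,r}`.

Put `Λ_n = (D_n + N) ⋯ (D_1 + N)` and `W_{n,m} = Λ_n^{d_m} w_{n,m}`. The two recursions combine to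
`W_{n,m+1} = e_{m+1} - ∑_{i ≤ n} u_m^{q^i} Λ_i^{-s_m} W_{i,m}`, with `W_{n,1} = e_1`,
(`IsLogCoeff.scaledColumn_succ_right`), where `e_m` is the standard basis vector at the end of
block `m`; iterating in `m` produces nested sums over `i_r ≥ i_{r-1} ≥ ⋯`. Two facts about `Λ_n` finish
the proof.

* The row of `N` at the end of a block vanishes, so on that coordinate `Λ_n` acts as the scalar
  `L_n`. The nested sums become truncated star polylogarithms
  (`IsLogCoeff.scaledColumn_blockEnd`), and summing over the largest index gives the claimed value
  (`IsLogCoeff.hasSum_blockEnd`).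
* The absolute value is ultrametric, `‖N‖ ≤ 1` and `‖D_i‖ > 1`, so `‖Λ_n x‖ = ‖L_n‖ ‖x‖` for the sup
  norm (`norm_shiftProd_mulVec`). Together with
  `‖u^{q^n} / L_n^s‖ = c (‖u‖ / c)^{q^n}`, `c = q^{s q/(q-1)}` (`norm_pow_div_carlitzL_pow`), this
  bounds all `W_{n,m}` and makes the terms `P_n v⁽ⁿ⁾` tend to zero because of the strict inequality
  for `u_r`; in a complete ultrametric group that is convergence (`IsLogCoeff.summable`).

The matrices `Λ_n` are never inverted: the identities are stated for `scaledColumn`, the vectors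
`Λ_n^k w_{n,m}`, and the powers of `Λ_n` are cancelled in the norm or in a coordinate.
-/

noncomputable section

open scoped Polynomial Matrix

namespace CarlitzStar

/-! ### The absolute value of `ℂ_∞` -/

section Norm

variable (F : Type*) [Field F] [Fintype F]

instance : IsUltrametricDist (KInftyAlg F) :=
  IsUltrametricDist.isUltrametricDist_of_isNonarchimedean_norm
    (isNonarchimedean_spectralNorm (K := KInfty F) (L := KInftyAlg F))

instance : IsUltrametricDist (CInfty F) :=
  IsUltrametricDist.isUltrametricDist_of_forall_norm_add_le_max_norm fun x y => by
    change UniformSpace.Completion (KInftyAlg F) at x y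
    change ‖(x + y : UniformSpace.Completion (KInftyAlg F))‖ ≤ max ‖x‖ ‖y‖
    induction x, y using UniformSpace.Completion.induction_on₂ with
    | hp => exact isClosed_le (by fun_prop) (by fun_prop)
    | ih x y =>
      rw [← UniformSpace.Completion.coe_add]
      simp only [UniformSpace.Completion.norm_coe]
      exact IsUltrametricDist.norm_add_le_max x y

theorem norm_theta : ‖theta F (CInfty F)‖ = Fintype.card F := by
  have h1 : ‖(((algebraMap (KInfty F) (KInftyAlg F)) (toKInfty F RatFunc.X) : KInftyAlg F) :
      UniformSpace.Completion (KInftyAlg F))‖ = Fintype.card F := by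
    rw [UniformSpace.Completion.norm_coe]
    refine (spectralNorm_extends _).trans ?_
    change ‖((WithAbs.toAbs (inftyAbs F) RatFunc.X : WithAbs (inftyAbs F)) : KInfty F)‖ = _
    rw [UniformSpace.Completion.norm_coe, WithAbs.norm_toAbs_eq, inftyAbs_X]
  exact h1

variable {F}

theorem norm_theta_sub_pow (n : ℕ) (hn : n ≠ 0) :
    ‖theta F (CInfty F) - theta F (CInfty F) ^ Fintype.card F ^ n‖ =
      (Fintype.card F : ℝ) ^ Fintype.card F ^ n := by
  have hq : 1 < Fintype.card F := Fintype.one_lt_card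
  have hlt : ‖theta F (CInfty F)‖ < ‖-theta F (CInfty F) ^ Fintype.card F ^ n‖ := by
    rw [norm_neg, norm_pow, norm_theta]
    exact_mod_cast lt_self_pow₀ hq (Nat.one_lt_pow hn hq)
  rw [sub_eq_add_neg, IsUltrametricDist.norm_add_eq_max_of_norm_ne_norm hlt.ne,
    max_eq_right hlt.le, norm_neg, norm_pow, norm_theta]

theorem one_lt_norm_theta_sub_pow (n : ℕ) (hn : n ≠ 0) :
    1 < ‖theta F (CInfty F) - theta F (CInfty F) ^ Fintype.card F ^ n‖ := by
  have hq : 1 < Fintype.card F := Fintype.one_lt_card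
  rw [norm_theta_sub_pow n hn]
  exact one_lt_pow₀ (by exact_mod_cast hq) (pow_pos (by omega) _).ne'

theorem carlitzL_zero : carlitzL F 0 = 1 := by simp [carlitzL]

theorem carlitzL_succ (n : ℕ) : carlitzL F (n + 1) =
    (theta F (CInfty F) - theta F (CInfty F) ^ Fintype.card F ^ (n + 1)) * carlitzL F n := by
  rw [carlitzL, Finset.prod_Icc_succ_top (by omega), mul_comm, carlitzL]

theorem carlitzL_ne_zero (n : ℕ) : carlitzL F n ≠ 0 := by
  refine Finset.prod_ne_zero_iff.mpr fun j hj => ?_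
  rw [← norm_pos_iff]
  have : j ≠ 0 := by
    have := (Finset.mem_Icc.mp hj).1
    omega
  exact zero_lt_one.trans (one_lt_norm_theta_sub_pow j this)

variable (F) in
/-- The radius `q^{s q/(q-1)}` of convergence of the `s`-th Carlitz polylogarithm. -/
def radius (s : ℕ) : ℝ :=
  (Fintype.card F : ℝ) ^ ((s * Fintype.card F : ℝ) / (Fintype.card F - 1))

theorem radius_pos (s : ℕ) : 0 < radius F s :=
  Real.rpow_pos_of_pos (by exact_mod_cast Fintype.card_pos) _

theorem radius_pow_card (s : ℕ) :
    radius F s ^ Fintype.card F = radius F s * ((Fintype.card F : ℝ) ^ s) ^ Fintype.card F := by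
  have hq : 1 < Fintype.card F := Fintype.one_lt_card
  have hq' : (1 : ℝ) < Fintype.card F := by exact_mod_cast hq
  have h0 : (0 : ℝ) < Fintype.card F := by linarith
  rw [radius, ← Real.rpow_natCast, ← Real.rpow_mul h0.le, ← pow_mul,
    ← Real.rpow_natCast _ (s * _), ← Real.rpow_add h0]
  congr 1
  have : (Fintype.card F : ℝ) - 1 ≠ 0 := by linarith
  push_cast
  field_simp
  ring

/-- The norm of `L_n^s` is, up to the factor `radius F s`, the `q^n`-th power of that radius. -/
theorem norm_carlitzL_pow_mul_radius (s n : ℕ) :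
    ‖carlitzL F n‖ ^ s * radius F s = radius F s ^ Fintype.card F ^ n := by
  induction n with
  | zero => simp [carlitzL_zero]
  | succ n ih =>
    rw [carlitzL_succ, norm_mul, norm_theta_sub_pow _ n.succ_ne_zero, mul_pow, mul_assoc, ih,
      pow_succ' (Fintype.card F) n, pow_mul (radius F s), radius_pow_card, mul_pow, mul_comm]
    simp only [← pow_mul]
    congr 2
    ring

theorem norm_pow_div_carlitzL_pow (z : CInfty F) (s n : ℕ) :
    ‖z ^ Fintype.card F ^ n / carlitzL F n ^ s‖ =
      radius F s * (‖z‖ / radius F s) ^ Fintype.card F ^ n := by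
  have h1 := norm_carlitzL_pow_mul_radius (F := F) s n
  have h2 : ‖carlitzL F n‖ ^ s ≠ 0 := pow_ne_zero _ (norm_ne_zero_iff.mpr (carlitzL_ne_zero n))
  have h3 := (radius_pos (F := F) s).ne'
  rw [norm_div, norm_pow, norm_pow, div_pow, ← h1]
  field_simp

theorem norm_pow_div_carlitzL_pow_le {z : CInfty F} {s : ℕ} (hz : ‖z‖ ≤ radius F s) (n : ℕ) :
    ‖z ^ Fintype.card F ^ n / carlitzL F n ^ s‖ ≤ radius F s := by
  rw [norm_pow_div_carlitzL_pow]
  exact mul_le_of_le_one_right (radius_pos s).le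
    (pow_le_one₀ (div_nonneg (norm_nonneg _) (radius_pos s).le) ((div_le_one (radius_pos s)).mpr hz))

theorem tendsto_pow_div_carlitzL_pow {z : CInfty F} {s : ℕ} (hz : ‖z‖ < radius F s) :
    Filter.Tendsto (fun n => ‖z ^ Fintype.card F ^ n / carlitzL F n ^ s‖) Filter.atTop
      (nhds 0) := by
  simp only [norm_pow_div_carlitzL_pow]
  rw [← mul_zero (radius F s)]
  refine Filter.Tendsto.const_mul _ ?_
  exact (tendsto_pow_atTop_nhds_zero_of_lt_one (div_nonneg (norm_nonneg _) (radius_pos s).le)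
    ((div_lt_one (radius_pos s)).mpr hz)).comp
      (tendsto_pow_atTop_atTop_of_one_lt Fintype.one_lt_card)

end Norm

/-! ### The matrices `c I + N` -/

section Shift

variable {K : Type*} [Field K] {r : ℕ} {s : Fin r → ℕ}

theorem matN_apply (x y : BlockIndex s) :
    matN K s x y = if x.1 = y.1 ∧ (y.2 : ℕ) = x.2 + 1 then 1 else 0 := by
  obtain ⟨ℓ, i⟩ := x
  obtain ⟨m, j⟩ := y
  rw [matN, Matrix.blockDiagonal'_apply]
  by_cases h : ℓ = m
  · subst h
    simp
  · rw [dif_neg h, if_neg fun h' => h h'.1]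

/-- The matrix `c I + N`. -/
def shiftMatrix (s : Fin r → ℕ) (c : K) : Matrix (BlockIndex s) (BlockIndex s) K :=
  Matrix.scalar _ c + matN K s

theorem shiftMatrix_mulVec (c : K) (v : BlockIndex s → K) :
    shiftMatrix s c *ᵥ v = c • v + matN K s *ᵥ v := by
  rw [shiftMatrix, Matrix.add_mulVec, Matrix.scalar_apply]
  congr 1
  ext x
  simp [Matrix.mulVec_diagonal]

theorem shiftMatrix_commute (c c' : K) : Commute (shiftMatrix s c) (shiftMatrix s c') := by
  have h (d : K) (A : Matrix (BlockIndex s) (BlockIndex s) K) : Commute (Matrix.scalar _ d) A :=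
    Matrix.scalar_commute d (fun r => Commute.all _ r) A
  exact (h c _).add_left ((h c' _).symm.add_right (Commute.refl _))

theorem mul_matN_apply_zero (P : Matrix (BlockIndex s) (BlockIndex s) K) (x : BlockIndex s)
    (ℓ : Fin r) (h : 0 < blockSize s ℓ) : (P * matN K s) x ⟨ℓ, 0, h⟩ = 0 := by
  rw [Matrix.mul_apply]
  exact Finset.sum_eq_zero fun y _ => by simp [matN_apply]

theorem mul_matN_apply_succ (P : Matrix (BlockIndex s) (BlockIndex s) K) (x : BlockIndex s)
    (ℓ : Fin r) (j : ℕ) (h : j + 1 < blockSize s ℓ) :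
    (P * matN K s) x ⟨ℓ, j + 1, h⟩ = P x ⟨ℓ, j, by omega⟩ := by
  rw [Matrix.mul_apply, Finset.sum_eq_single ⟨ℓ, j, by omega⟩ _ (by simp)]
  · simp [matN_apply]
  · rintro ⟨m, i⟩ _ hy
    rw [matN_apply, if_neg, mul_zero]
    rintro ⟨rfl, h2⟩
    have h3 : j = i := Nat.add_right_cancel h2
    subst h3
    exact hy rfl

end Shift

/-! ### The functional equation of the logarithm -/

section Log

variable {F : Type*} [Field F] [Fintype F] {L : Type*} [Field L] [Algebra F L]
  [Algebra (RatFunc F) L]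

theorem TModule.log_coeff_zero {ι : Type*} [Fintype ι] [DecidableEq ι] (G : TModule F L ι) :
    G.log.coeff 0 = 1 := by
  have h : G.log * G.exp = 1 := G.isUnit_exp.val_inv_mul
  have h0 := congrArg (TwistedSeries.coeffZero _) h
  rw [map_mul, map_one] at h0
  change G.log.coeff 0 * G.exp.coeff 0 = 1 at h0
  rwa [G.isExp_exp.1, mul_one] at h0

/-- `log_G ∘ ρ_a = ∂ρ_a ∘ log_G`. -/
theorem TModule.log_mul_rho {ι : Type*} [Fintype ι] [DecidableEq ι] (G : TModule F L ι)
    (a : F[X]) : G.log * (G.ρ a : MatSeries F L ι) =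
      TwistedSeries.const _ (G.dRho a) * G.log := by
  have h1 : G.log * G.exp = 1 := G.isUnit_exp.val_inv_mul
  have h2 : G.exp * G.log = 1 := G.isUnit_exp.mul_val_inv
  calc G.log * (G.ρ a : MatSeries F L ι)
      = G.log * ((G.ρ a : MatSeries F L ι) * G.exp) * G.log := by
        rw [mul_assoc, mul_assoc, h2, mul_one]
    _ = TwistedSeries.const _ (G.dRho a) * G.log := by
        rw [G.isExp_exp.2, ← mul_assoc, h1, one_mul]

variable {r : ℕ} (s : Fin r → ℕ)

/-- The recursion for the coefficients of `log_G` coming from `log_G ∘ ρ_t = ∂ρ_t ∘ log_G`. -/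
theorem shiftMatrix_mul_log_coeff (u : Fin r → L) (n : ℕ) :
    shiftMatrix s (theta F L - theta F L ^ Fintype.card F ^ (n + 1)) *
        (tModule F s u).log.coeff (n + 1) =
      (tModule F s u).log.coeff (n + 1) * matN L s +
        (tModule F s u).log.coeff n * (matE s u).map (· ^ Fintype.card F ^ n) := by
  set G := tModule F s u with hG
  have hρ : G.ρ Polynomial.X = rhoT F s u := TModule.ofRhoT_ρ_X _ _
  have hd : G.dRho Polynomial.X = Matrix.scalar _ (theta F L) + matN L s := by
    rw [TModule.dRho, hρ]
    rfl
  have hE : (matFrob F L (BlockIndex s) ^ n) (matE s u) =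
      (matE s u).map (· ^ Fintype.card F ^ n) := by
    ext x y
    rw [matFrob_pow_apply, Matrix.map_apply]
  have hN : (matFrob F L (BlockIndex s) ^ (n + 1)) (matN L s) = matN L s := by
    ext x y
    rw [matFrob_pow_apply, matN_apply]
    split_ifs <;> simp
  have h : (G.log * (G.ρ Polynomial.X : MatSeries F L _)).coeff (n + 1) =
      (TwistedSeries.const _ (G.dRho Polynomial.X) * G.log).coeff (n + 1) := by
    rw [G.log_mul_rho]
  rw [TwistedSeries.coeff_const_mul, TwistedSeries.coeff_mul, hd, hρ,
    Finset.Nat.sum_antidiagonal_eq_sum_range_succ_mk, Finset.sum_range_succ,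
    Finset.sum_range_succ, Finset.sum_eq_zero, zero_add] at h
  · have h0 : (rhoT F s u : MatSeries F L (BlockIndex s)).coeff (n + 1 - (n + 1)) =
        Matrix.scalar _ (theta F L) + matN L s := by
      rw [Nat.sub_self]
      rfl
    have h1 : (rhoT F s u : MatSeries F L (BlockIndex s)).coeff (n + 1 - n) = matE s u := by
      rw [Nat.add_sub_cancel_left]
      rfl
    rw [h0, h1, hE, map_add, matFrob_pow_scalar, hN] at h
    have hc := (Matrix.scalar_commute (theta F L ^ Fintype.card F ^ (n + 1))
      (fun r => Commute.all _ r) (G.log.coeff (n + 1))).eq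
    rw [shiftMatrix, map_sub, add_mul, sub_mul, hc]
    rw [add_mul, mul_add] at h
    rw [sub_add_eq_add_sub, ← h]
    abel
  · intro i hi
    have hi' := Finset.mem_range.mp hi
    have h2 : (rhoT F s u : MatSeries F L (BlockIndex s)).coeff (n + 1 - i) = 0 := by
      change (if n + 1 - i = 0 then _ else if n + 1 - i = 1 then _ else _) = _
      rw [if_neg (by omega), if_neg (by omega)]
    simp only [h2, map_zero, mul_zero]

end Log

/-! ### Base change of the data defining the `t`-module -/

section Map

variable {K L : Type*} [Field K] [Field L] (f : L →+* K) {r : ℕ} (s : Fin r → ℕ)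

theorem map_matN : (matN L s).map f = matN K s := by
  ext x y
  rw [Matrix.map_apply, matN_apply, matN_apply]
  split_ifs <;> simp

theorem map_shiftMatrix (c : L) : (shiftMatrix s c).map f = shiftMatrix s (f c) := by
  rw [shiftMatrix, shiftMatrix, Matrix.map_add f (map_add f), map_matN]
  congr 1
  ext x y
  by_cases h : x = y <;> simp [h]

theorem map_matE (u : Fin r → L) : (matE s u).map f = matE s fun i => f (u i) := by
  ext x y
  simp only [Matrix.map_apply, matE, Matrix.of_apply]
  split_ifs <;> simp

theorem map_specialPoint (u : Fin r → L) (x : BlockIndex s) :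
    f (specialPoint s u x) = specialPoint s (fun i => f (u i)) x := by
  simp only [specialPoint]
  split_ifs <;> simp

end Map

/-! ### The columns of the coefficients of the logarithm -/

section Columns

variable {K : Type*} [Field K] {r : ℕ} {s : Fin r → ℕ}

theorem blockSize_pos (hs : ∀ i, 0 < s i) (ℓ : Fin r) : 0 < blockSize s ℓ :=
  Finset.sum_pos (fun i _ => hs i) ⟨ℓ, Finset.mem_Ici.mpr le_rfl⟩

/-- The last index of block `ℓ`. -/
def blockEnd (hs : ∀ i, 0 < s i) (ℓ : Fin r) : BlockIndex s :=
  ⟨ℓ, blockSize s ℓ - 1, Nat.sub_lt (blockSize_pos hs ℓ) one_pos⟩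

theorem isBlockEnd_blockEnd (hs : ∀ i, 0 < s i) (ℓ : Fin r) : IsBlockEnd (blockEnd hs ℓ) :=
  Nat.sub_add_cancel (blockSize_pos hs ℓ)

theorem IsBlockEnd.eq_blockEnd (hs : ∀ i, 0 < s i) {x : BlockIndex s} (hx : IsBlockEnd x) :
    x = blockEnd hs x.1 := by
  obtain ⟨ℓ, j⟩ := x
  rw [blockEnd]
  congr 1
  ext
  exact Nat.eq_sub_of_add_eq hx

theorem sum_eq_sum_blockEnd (hs : ∀ i, 0 < s i) {M : Type*} [AddCommMonoid M]
    (g : BlockIndex s → M) (hg : ∀ x, ¬ IsBlockEnd x → g x = 0) :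
    ∑ x, g x = ∑ ℓ, g (blockEnd hs ℓ) := by
  rw [Fintype.sum_sigma]
  refine Finset.sum_congr rfl fun ℓ _ => ?_
  refine Fintype.sum_eq_single (⟨blockSize s ℓ - 1, Nat.sub_lt (blockSize_pos hs ℓ) one_pos⟩ :
    Fin (blockSize s ℓ)) fun j hj => hg _ fun h => hj ?_
  ext
  exact Nat.eq_sub_of_add_eq h

theorem matN_mulVec_blockEnd (hs : ∀ i, 0 < s i) (ℓ : Fin r) (v : BlockIndex s → K) :
    (matN K s *ᵥ v) (blockEnd hs ℓ) = 0 := by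
  rw [Matrix.mulVec, dotProduct]
  refine Finset.sum_eq_zero fun y _ => ?_
  rw [matN_apply, if_neg, zero_mul]
  rintro ⟨h1, h2⟩
  have h3 := y.2.2
  have h4 : (y.2 : ℕ) = blockSize s ℓ - 1 + 1 := h2
  rw [Nat.sub_one_add_one (blockSize_pos hs ℓ).ne'] at h4
  exact (h3.trans_eq (congrArg (blockSize s) h1).symm).ne h4

/-- Extension of a tuple by zero to all natural numbers. -/
def extendZero {α : Type*} [Zero α] (a : Fin r → α) (m : ℕ) : α :=
  if h : m < r then a ⟨m, h⟩ else 0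

theorem extendZero_coe {α : Type*} [Zero α] (a : Fin r → α) (i : Fin r) :
    extendZero a i = a i := dif_pos i.2

theorem extendZero_of_lt {α : Type*} [Zero α] (a : Fin r → α) {m : ℕ} (h : m < r) :
    extendZero a m = a ⟨m, h⟩ := dif_pos h

theorem prod_Ico_eq_extendZero (u : Fin r → K) (a b : Fin r) :
    ∏ e ∈ Finset.Ico a b, u e = ∏ e ∈ Finset.Ico (a : ℕ) b, extendZero u e := by
  rw [← Fin.map_valEmbedding_Ico, Finset.prod_map]
  simp [extendZero_coe]

theorem prod_Ici_eq_extendZero (u : Fin r → K) (a : Fin r) :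
    ∏ e ∈ Finset.Ici a, u e = ∏ e ∈ Finset.Ico (a : ℕ) r, extendZero u e := by
  rw [← Fin.map_valEmbedding_Ici, Finset.prod_map]
  simp [extendZero_coe]

theorem blockSize_eq_extendZero (ℓ : Fin r) :
    blockSize s ℓ = ∑ e ∈ Finset.Ico (ℓ : ℕ) r, extendZero s e := by
  rw [← Fin.map_valEmbedding_Ici, Finset.sum_map]
  simp [extendZero_coe, blockSize]

/-- The column of a matrix at the last index of block `m`, for `m < r`, and zero for `m ≥ r`. -/
def endColumn (hs : ∀ i, 0 < s i) (P : Matrix (BlockIndex s) (BlockIndex s) K) :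
    ℕ → BlockIndex s → K :=
  extendZero fun ℓ x => P x (blockEnd hs ℓ)

/-- The sums `∑_{ℓ ≤ m} (-1)^(m-ℓ) a_ℓ ⋯ a_{m-1} p_ℓ`, given by the recursion that they satisfy. -/
def altSum {V : Type*} [AddCommGroup V] [Module K V] (a : ℕ → K) (p : ℕ → V) : ℕ → V
  | 0 => p 0
  | m + 1 => p (m + 1) - a m • altSum a p m

theorem altSum_eq_sum {V : Type*} [AddCommGroup V] [Module K V] (a : ℕ → K) (p : ℕ → V) (m : ℕ) :
    altSum a p m =
      ∑ ℓ ∈ Finset.range (m + 1), ((-1) ^ (m - ℓ) * ∏ e ∈ Finset.Ico ℓ m, a e) • p ℓ := by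
  induction m with
  | zero => simp [altSum]
  | succ m ih =>
    rw [altSum, ih, Finset.sum_range_succ _ (m + 1), Finset.smul_sum, sub_eq_add_neg, add_comm,
      ← Finset.sum_neg_distrib]
    congr 1
    · refine Finset.sum_congr rfl fun ℓ hℓ => ?_
      have hℓ' : ℓ ≤ m := Nat.lt_succ_iff.mp (Finset.mem_range.mp hℓ)
      rw [Finset.prod_Ico_succ_top hℓ', Nat.succ_sub hℓ', pow_succ, smul_smul, ← neg_smul]
      congr 1
      ring
    · simp

/-- `altSum` computes the columns of `P E⁽ⁿ⁾` at the first indices of the blocks. -/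
theorem mul_map_matE_apply_zero (hs : ∀ i, 0 < s i) (u : Fin r → K) {q : ℕ} (hq : q ≠ 0)
    (hneg : (-1 : K) ^ q = -1) (P : Matrix (BlockIndex s) (BlockIndex s) K) (x : BlockIndex s)
    (m : Fin r) (h : 0 < blockSize s m) :
    (P * (matE s u).map (· ^ q)) x ⟨m, 0, h⟩ =
      altSum (fun e => extendZero u e ^ q) (endColumn hs P) m x := by
  rw [Matrix.mul_apply, sum_eq_sum_blockEnd hs, altSum_eq_sum, Finset.sum_apply]
  · have hsub : Finset.range (m + 1) = (Finset.range r).filter (· ≤ (m : ℕ)) := by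
      ext e
      simp only [Finset.mem_range, Finset.mem_filter]
      have := m.2
      omega
    rw [hsub, Finset.sum_filter, ← Fin.sum_univ_eq_sum_range (fun e => if e ≤ (m : ℕ) then _ else _)]
    refine Finset.sum_congr rfl fun ℓ _ => ?_
    simp only [Matrix.map_apply, matE, Matrix.of_apply, isBlockEnd_blockEnd, and_true]
    change P x (blockEnd hs ℓ) * (if ℓ ≤ m then _ else _) ^ q = if (ℓ : ℕ) ≤ (m : ℕ) then _ else _
    simp only [Fin.val_fin_le]
    split_ifs with hℓ
    · rw [Pi.smul_apply, smul_eq_mul, endColumn, extendZero_coe, mul_pow, ← pow_mul, mul_comm _ q,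
        pow_mul, hneg, prod_Ico_eq_extendZero, Finset.prod_pow, mul_comm]
      rfl
    · rw [zero_pow hq, mul_zero]
  · intro y hy
    simp [matE, hy, hq]

/-- `altSum` computes the term `P v⁽ⁿ⁾` of the logarithmic series at the special point. -/
theorem mulVec_specialPoint_pow (hs : ∀ i, 0 < s i) (u : Fin r → K) {q : ℕ} (hq : q ≠ 0)
    (hneg : (-1 : K) ^ q = -1) (P : Matrix (BlockIndex s) (BlockIndex s) K) {m : ℕ}
    (hm : m + 1 = r) :
    P *ᵥ (fun x => specialPoint s u x ^ q) =
      extendZero u m ^ q • altSum (fun e => extendZero u e ^ q) (endColumn hs P) m := by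
  ext x
  rw [Matrix.mulVec, dotProduct, sum_eq_sum_blockEnd hs]
  · rw [altSum_eq_sum, Finset.smul_sum, Finset.sum_apply, hm, ← Fin.sum_univ_eq_sum_range
      (fun ℓ => (extendZero u m ^ q •
        ((-1 : K) ^ (m - ℓ) * ∏ e ∈ Finset.Ico ℓ m, extendZero u e ^ q) • endColumn hs P ℓ) x)]
    refine Finset.sum_congr rfl fun ℓ _ => ?_
    have hℓ : (ℓ : ℕ) ≤ m := by
      have := ℓ.2
      omega
    have hexp : r - ((ℓ : ℕ) + 1) = m - ℓ := by omega
    simp only [specialPoint, isBlockEnd_blockEnd, if_true, Pi.smul_apply, smul_eq_mul, endColumn,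
      extendZero_coe]
    change P x (blockEnd hs ℓ) * ((-1) ^ (r - ((ℓ : ℕ) + 1)) * ∏ e ∈ Finset.Ici ℓ, u e) ^ q = _
    have hprod : ∏ e ∈ Finset.Ici ℓ, u e =
        (∏ e ∈ Finset.Ico (ℓ : ℕ) m, extendZero u e) * extendZero u m := by
      rw [← Finset.prod_Ico_succ_top hℓ, prod_Ici_eq_extendZero, hm]
    rw [hprod, hexp, mul_pow, ← pow_mul, mul_comm _ q, pow_mul, hneg, Finset.prod_pow, mul_pow]
    ring
  · intro y hy
    simp [specialPoint, hy, hq]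

/-- Solving the recursion for the coefficients of the logarithm along the columns of one block. -/
theorem shiftMatrix_pow_mulVec_endColumn (hs : ∀ i, 0 < s i) (u : Fin r → K) {q : ℕ} (hq : q ≠ 0)
    (hneg : (-1 : K) ^ q = -1) {c : K} {P P' : Matrix (BlockIndex s) (BlockIndex s) K}
    (hP : shiftMatrix s c * P' = P' * matN K s + P * (matE s u).map (· ^ q)) {m : ℕ} (hm : m < r) :
    shiftMatrix s c ^ (∑ e ∈ Finset.Ico m r, extendZero s e) *ᵥ endColumn hs P' m =
      altSum (fun e => extendZero u e ^ q) (endColumn hs P) m := by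
  have hcol (y : BlockIndex s) : shiftMatrix s c *ᵥ (fun x => P' x y) =
      fun x => (P' * matN K s) x y + (P * (matE s u).map (· ^ q)) x y := by
    ext x
    exact congrFun (congrFun hP x) y
  have key (j : ℕ) (hj : j < blockSize s ⟨m, hm⟩) :
      shiftMatrix s c ^ (j + 1) *ᵥ (fun x => P' x ⟨⟨m, hm⟩, j, hj⟩) =
        altSum (fun e => extendZero u e ^ q) (endColumn hs P) m := by
    induction j with
    | zero =>
      rw [zero_add, pow_one, hcol]
      ext x
      rw [mul_matN_apply_zero, zero_add, mul_map_matE_apply_zero hs u hq hneg]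
    | succ j ih =>
      rw [pow_succ, ← Matrix.mulVec_mulVec, hcol, ← ih (by omega)]
      congr 1
      ext x
      rw [mul_matN_apply_succ, add_eq_left, Matrix.mul_apply]
      exact Finset.sum_eq_zero fun y _ => by simp [matE, hq]
  have h := key (blockSize s ⟨m, hm⟩ - 1) (Nat.sub_lt (blockSize_pos hs _) one_pos)
  rw [Nat.sub_one_add_one (blockSize_pos hs _).ne'] at h
  have hsize : blockSize s ⟨m, hm⟩ = ∑ e ∈ Finset.Ico m r, extendZero s e :=
    blockSize_eq_extendZero _
  rw [endColumn, extendZero_of_lt _ hm, ← hsize]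
  exact h

end Columns

/-! ### Sums over antitone tuples -/

section Antitone

theorem antitone_cons {l : ℕ} {a : ℕ} {i : Fin l → ℕ} :
    Antitone (Fin.cons a i : Fin (l + 1) → ℕ) ↔ Antitone i ∧ ∀ j, i j ≤ a := by
  constructor
  · intro h
    refine ⟨fun x y hxy => ?_, fun j => ?_⟩
    · simpa using h (Fin.succ_le_succ_iff.mpr hxy)
    · simpa using h (Fin.zero_le j.succ)
  · rintro ⟨h1, h2⟩ x y hxy
    induction x using Fin.cases with
    | zero =>
      induction y using Fin.cases with
      | zero => simp
      | succ y => simpa using h2 y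
    | succ x =>
      induction y using Fin.cases with
      | zero => simp at hxy
      | succ y => simpa using h1 (Fin.succ_le_succ_iff.mp hxy)

open Classical in
/-- The antitone tuples of length `l` with entries at most `n`. -/
def antitoneTuples (l n : ℕ) : Finset (Fin l → ℕ) :=
  (Fintype.piFinset fun _ => Finset.range (n + 1)).filter Antitone

theorem mem_antitoneTuples {l n : ℕ} {i : Fin l → ℕ} :
    i ∈ antitoneTuples l n ↔ Antitone i ∧ ∀ j, i j ≤ n := by
  simp [antitoneTuples, and_comm]

/-- An antitone tuple is its first entry `a` followed by an antitone tuple bounded by `a`. -/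
def antitoneConsEquiv (l : ℕ) :
    (Σ a : ℕ, {i : Fin l → ℕ // i ∈ antitoneTuples l a}) ≃ {i : Fin (l + 1) → ℕ // Antitone i} where
  toFun x := ⟨Fin.cons x.1 x.2.1, antitone_cons.mpr (mem_antitoneTuples.mp x.2.2)⟩
  invFun i := ⟨i.1 0, Fin.tail i.1, mem_antitoneTuples.mpr
    (antitone_cons.mp (by rw [Fin.cons_self_tail]; exact i.2))⟩
  left_inv x := rfl
  right_inv i := Subtype.ext (Fin.cons_self_tail _)

variable {K : Type*}

/-- The truncated nested sum `∑ c 0 (i_0) ⋯ c (l-1) (i_{l-1})` over `n ≥ i_0 ≥ ⋯ ≥ i_{l-1}`. -/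
def nestedSum [CommSemiring K] {l : ℕ} (c : Fin l → ℕ → K) (n : ℕ) : K :=
  ∑ i ∈ antitoneTuples l n, ∏ j, c j (i j)

theorem nestedSum_zero [CommSemiring K] (c : Fin 0 → ℕ → K) (n : ℕ) : nestedSum c n = 1 := by
  have : antitoneTuples 0 n = {0} := by
    ext i
    simp [mem_antitoneTuples, Subsingleton.elim i 0, Subsingleton.antitone]
  simp [nestedSum, this]

theorem nestedSum_succ [CommSemiring K] {l : ℕ} (c : Fin (l + 1) → ℕ → K) (n : ℕ) :
    nestedSum c n = ∑ a ∈ Finset.range (n + 1), c 0 a * nestedSum (fun j => c j.succ) a := by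
  simp only [nestedSum, Finset.mul_sum]
  rw [Finset.sum_sigma']
  refine (Finset.sum_bij' (fun x _ => Fin.cons x.1 x.2)
    (fun i _ => (⟨i 0, Fin.tail i⟩ : Σ _ : ℕ, Fin l → ℕ)) ?_ ?_ ?_ ?_ ?_).symm
  · rintro ⟨a, i⟩ h
    simp only [Finset.mem_sigma, Finset.mem_range, mem_antitoneTuples] at h ⊢
    refine ⟨antitone_cons.mpr h.2, fun j => ?_⟩
    have := (antitone_cons.mpr h.2) (Fin.zero_le j)
    simp only [Fin.cons_zero] at this
    omega
  · intro i h
    rw [mem_antitoneTuples] at h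
    simp only [Finset.mem_sigma, Finset.mem_range, mem_antitoneTuples]
    refine ⟨Nat.lt_succ_iff.mpr (h.2 0), antitone_cons.mp ?_⟩
    rw [Fin.cons_self_tail]
    exact h.1
  · rintro ⟨a, i⟩ _
    simp
  · intro i _
    exact Fin.cons_self_tail i
  · rintro ⟨a, i⟩ _
    simp [Fin.prod_univ_succ]

/-- Summing over antitone tuples, the first entry last. -/
theorem hasSum_mul_nestedSum [NormedField K] {l : ℕ} (c : Fin (l + 1) → ℕ → K)
    (h : Summable fun i : {i : Fin (l + 1) → ℕ // Antitone i} => ∏ j, c j (i.1 j)) :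
    HasSum (fun n => c 0 n * nestedSum (fun j => c j.succ) n)
      (∑' i : {i : Fin (l + 1) → ℕ // Antitone i}, ∏ j, c j (i.1 j)) := by
  have h1 := (antitoneConsEquiv l).hasSum_iff.mpr h.hasSum
  refine h1.sigma fun n => ?_
  have h2 := hasSum_fintype fun i : {i : Fin l → ℕ // i ∈ antitoneTuples l n} =>
    c 0 n * ∏ j : Fin l, c j.succ (i.1 j)
  rw [Finset.univ_eq_attach, Finset.sum_attach (antitoneTuples l n)
    (fun i => c 0 n * ∏ j : Fin l, c j.succ (i j)), ← Finset.mul_sum] at h2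
  refine h2.congr_fun fun i => ?_
  change ∏ j, c j ((Fin.cons n i.1 : Fin (l + 1) → ℕ) j) = _
  simp [Fin.prod_univ_succ]

/-- Over a complete ultrametric field, the nested series converges as soon as all factors are
bounded and the one with the largest index tends to zero. -/
theorem summable_antitone_prod [NormedField K] [CompleteSpace K] [IsUltrametricDist K] {l : ℕ}
    (c : Fin (l + 1) → ℕ → K) (C : Fin (l + 1) → ℝ) (hC : ∀ j n, ‖c j n‖ ≤ C j)
    (h0 : Filter.Tendsto (fun n => ‖c 0 n‖) Filter.atTop (nhds 0)) :
    Summable fun i : {i : Fin (l + 1) → ℕ // Antitone i} => ∏ j, c j (i.1 j) := by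
  refine NonarchimedeanAddGroup.summable_of_tendsto_cofinite_zero ?_
  have hfirst : Filter.Tendsto (fun i : {i : Fin (l + 1) → ℕ // Antitone i} => i.1 0)
      Filter.cofinite Filter.atTop := by
    rw [← Nat.cofinite_eq_atTop]
    refine Filter.Tendsto.cofinite_of_finite_preimage_singleton fun n => ?_
    refine Set.Finite.of_finite_image (f := Subtype.val) ?_ Subtype.val_injective.injOn
    refine (antitoneTuples (l + 1) n).finite_toSet.subset ?_
    rintro _ ⟨i, hi, rfl⟩
    have hi0 : i.1 0 = n := hi
    exact Finset.mem_coe.mpr (mem_antitoneTuples.mpr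
      ⟨i.2, fun j => (i.2 (Fin.zero_le j)).trans hi0.le⟩)
  have h1 := (h0.comp hfirst).mul_const (∏ j : Fin l, C j.succ)
  rw [zero_mul] at h1
  refine squeeze_zero_norm (fun i => ?_) h1
  rw [norm_prod, Fin.prod_univ_succ]
  exact mul_le_mul_of_nonneg_left
    (Finset.prod_le_prod (fun _ _ => norm_nonneg _) fun j _ => hC _ _) (norm_nonneg _)

end Antitone

/-! ### The matrix analogues of the `L_i` -/

section ShiftProd

variable {F : Type*} [Field F] [Fintype F] {r : ℕ} {s : Fin r → ℕ}

/-- The matrix `(D_n I + N) ⋯ (D_1 I + N)` with `D_i = θ - θ^{q^i}`; it is `L_n I` modulo `N`. -/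
def shiftProd (F : Type*) [Field F] [Fintype F] {r : ℕ} (s : Fin r → ℕ) :
    ℕ → Matrix (BlockIndex s) (BlockIndex s) (CInfty F)
  | 0 => 1
  | n + 1 => shiftMatrix s (theta F (CInfty F) - theta F (CInfty F) ^ Fintype.card F ^ (n + 1)) *
      shiftProd F s n

theorem shiftMatrix_commute_shiftProd (c : CInfty F) (n : ℕ) :
    Commute (shiftMatrix s c) (shiftProd F s n) := by
  induction n with
  | zero => exact Commute.one_right _
  | succ n ih => exact (shiftMatrix_commute _ _).mul_right ih

theorem norm_matN_mulVec_le (v : BlockIndex s → CInfty F) :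
    ‖matN (CInfty F) s *ᵥ v‖ ≤ ‖v‖ := by
  refine (pi_norm_le_iff_of_nonneg (norm_nonneg v)).mpr fun x => ?_
  refine IsUltrametricDist.norm_sum_le_of_forall_le_of_nonneg (norm_nonneg v) fun y _ => ?_
  simp only [matN_apply]
  split_ifs
  · rw [one_mul]
    exact norm_le_pi_norm v y
  · rw [zero_mul, norm_zero]
    exact norm_nonneg v

/-- As `‖N‖ ≤ 1`, the matrix `c I + N` scales the sup norm by `‖c‖` if `‖c‖ > 1`. -/
theorem norm_shiftMatrix_mulVec {c : CInfty F} (hc : 1 < ‖c‖) (v : BlockIndex s → CInfty F) :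
    ‖shiftMatrix s c *ᵥ v‖ = ‖c‖ * ‖v‖ := by
  rcases eq_or_ne v 0 with rfl | hv
  · simp
  have hlt : ‖matN (CInfty F) s *ᵥ v‖ < ‖c • v‖ := by
    rw [norm_smul]
    exact (norm_matN_mulVec_le v).trans_lt (lt_mul_of_one_lt_left (norm_pos_iff.mpr hv) hc)
  rw [shiftMatrix_mulVec, IsUltrametricDist.norm_add_eq_max_of_norm_ne_norm hlt.ne',
    max_eq_left hlt.le, norm_smul]

theorem norm_shiftProd_mulVec (n : ℕ) (v : BlockIndex s → CInfty F) :
    ‖shiftProd F s n *ᵥ v‖ = ‖carlitzL F n‖ * ‖v‖ := by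
  induction n with
  | zero => simp [shiftProd, carlitzL_zero]
  | succ n ih =>
    rw [shiftProd, ← Matrix.mulVec_mulVec,
      norm_shiftMatrix_mulVec (one_lt_norm_theta_sub_pow _ n.succ_ne_zero), ih, carlitzL_succ,
      norm_mul, mul_assoc]

theorem norm_shiftProd_pow_mulVec (n k : ℕ) (v : BlockIndex s → CInfty F) :
    ‖shiftProd F s n ^ k *ᵥ v‖ = ‖carlitzL F n‖ ^ k * ‖v‖ := by
  induction k with
  | zero => simp
  | succ k ih =>
    rw [pow_succ', ← Matrix.mulVec_mulVec, norm_shiftProd_mulVec, ih, pow_succ']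
    ring

/-- On the last coordinates of the blocks, `N` acts as zero. -/
theorem shiftProd_pow_mulVec_blockEnd (hs : ∀ i, 0 < s i) (n k : ℕ) (v : BlockIndex s → CInfty F)
    (ℓ : Fin r) :
    (shiftProd F s n ^ k *ᵥ v) (blockEnd hs ℓ) = carlitzL F n ^ k * v (blockEnd hs ℓ) := by
  have h1 (n : ℕ) (v : BlockIndex s → CInfty F) :
      (shiftProd F s n *ᵥ v) (blockEnd hs ℓ) = carlitzL F n * v (blockEnd hs ℓ) := by
    induction n with
    | zero => simp [shiftProd, carlitzL_zero]
    | succ n ih =>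
      rw [shiftProd, ← Matrix.mulVec_mulVec, shiftMatrix_mulVec, Pi.add_apply,
        matN_mulVec_blockEnd, add_zero, Pi.smul_apply, ih, carlitzL_succ, smul_eq_mul, mul_assoc]
  induction k with
  | zero => simp
  | succ k ih => rw [pow_succ', ← Matrix.mulVec_mulVec, h1, ih, pow_succ', mul_assoc]

end ShiftProd

/-! ### The logarithmic series at the special point -/

section Main

variable {F : Type*} [Field F] [Fintype F] {r : ℕ} {s : Fin r → ℕ}

theorem neg_one_pow_card_pow (n : ℕ) : (-1 : CInfty F) ^ Fintype.card F ^ n = -1 := by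
  have h : (-1 : F) ^ Fintype.card F ^ n = -1 := FiniteField.pow_card_pow n _
  have := congrArg (algebraMap F (CInfty F)) h
  simpa only [map_pow, map_neg, map_one] using this

/-- A sequence of matrices `P_n` over `ℂ_∞` satisfies the relations that hold for the coefficients of the
logarithm of the `t`-module `G_{s,u}`. -/
structure IsLogCoeff (u : Fin r → CInfty F)
    (P : ℕ → Matrix (BlockIndex s) (BlockIndex s) (CInfty F)) : Prop where
  zero : P 0 = 1
  succ (n : ℕ) :
    shiftMatrix s (theta F (CInfty F) - theta F (CInfty F) ^ Fintype.card F ^ (n + 1)) * P (n + 1) =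
      P (n + 1) * matN (CInfty F) s + P n * (matE s u).map (· ^ Fintype.card F ^ n)

variable (hs : ∀ i, 0 < s i) (u : Fin r → CInfty F)
  (P : ℕ → Matrix (BlockIndex s) (BlockIndex s) (CInfty F))

/-- The columns `w_{n,m}` of `P_n E⁽ⁿ⁾`, multiplied by `Λ_n^k`, where `Λ_n` is `shiftProd F s n`. -/
def scaledColumn (k n m : ℕ) : BlockIndex s → CInfty F :=
  shiftProd F s n ^ k *ᵥ
    altSum (fun e => extendZero u e ^ Fintype.card F ^ n) (endColumn hs (P n)) m

/-- `d_{m+1} = s_{m+1} + ⋯ + s_r`, as a function on all natural numbers `m` (zero for `m ≥ r`). -/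
def tailSum (s : Fin r → ℕ) (m : ℕ) : ℕ := ∑ e ∈ Finset.Ico m r, extendZero s e

theorem tailSum_eq_add {m : ℕ} (hm : m < r) :
    tailSum s m = extendZero s m + tailSum s (m + 1) :=
  Finset.sum_eq_sum_Ico_succ_bot hm _

theorem shiftProd_pow_mulVec_scaledColumn (k l n m : ℕ) :
    shiftProd F s n ^ k *ᵥ scaledColumn hs u P l n m = scaledColumn hs u P (k + l) n m := by
  rw [scaledColumn, Matrix.mulVec_mulVec, ← pow_add, scaledColumn]

variable {u P}

theorem IsLogCoeff.shiftProd_pow_mulVec_endColumn (hP : IsLogCoeff u P) (n : ℕ) {m : ℕ}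
    (hm : m < r) :
    shiftProd F s (n + 1) ^ tailSum s m *ᵥ endColumn hs (P (n + 1)) m =
      scaledColumn hs u P (tailSum s m) n m := by
  rw [shiftProd, (shiftMatrix_commute_shiftProd _ n).mul_pow,
    ((shiftMatrix_commute_shiftProd _ n).pow_pow _ _).eq, ← Matrix.mulVec_mulVec, tailSum,
    shiftMatrix_pow_mulVec_endColumn hs u (pow_ne_zero _ Fintype.card_ne_zero)
      (neg_one_pow_card_pow n) (hP.succ n) hm]
  rfl

/-- Start of the recursion in `m`: in the first block, `Λ_n^{d_1} w_{n,1}` does not depend on `n`. -/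
theorem IsLogCoeff.scaledColumn_zero_right (hP : IsLogCoeff u P) (hr : 0 < r) (n : ℕ) :
    scaledColumn hs u P (tailSum s 0) n 0 = endColumn hs (P 0) 0 := by
  induction n with
  | zero => simp [scaledColumn, shiftProd, altSum]
  | succ n ih =>
    rw [← ih, ← hP.shiftProd_pow_mulVec_endColumn hs n hr]
    rfl

/-- The recursion in `m`, from which the nested sums arise. As `d_m = s_m + d_{m+1}`, the vector
`Λ_i^{d_{m+1}} w_{i,m}` in the sum is `Λ_i^{-s_m}` times `Λ_i^{d_m} w_{i,m}`. -/
theorem IsLogCoeff.scaledColumn_succ_right (hP : IsLogCoeff u P) (n : ℕ) {m : ℕ}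
    (hm : m + 1 < r) :
    scaledColumn hs u P (tailSum s (m + 1)) n (m + 1) = endColumn hs (P 0) (m + 1) -
      ∑ i ∈ Finset.range (n + 1), extendZero u m ^ Fintype.card F ^ i •
        scaledColumn hs u P (tailSum s (m + 1)) i m := by
  induction n with
  | zero => simp [scaledColumn, shiftProd, altSum]
  | succ n ih =>
    rw [Finset.sum_range_succ, ← sub_sub, ← ih, ← hP.shiftProd_pow_mulVec_endColumn hs n hm]
    rw [scaledColumn, altSum, Matrix.mulVec_sub, Matrix.mulVec_smul]
    rfl

theorem norm_endColumn_one_le (m : ℕ) :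
    ‖endColumn hs (1 : Matrix (BlockIndex s) (BlockIndex s) (CInfty F)) m‖ ≤ 1 := by
  refine (pi_norm_le_iff_of_nonneg zero_le_one).mpr fun x => ?_
  rw [endColumn, extendZero]
  split_ifs
  · simp only [Matrix.one_apply]
    split_ifs <;> simp
  · simp

/-- The norm of `u_m^{q^n} Λ_n^{d_{m+1}} w_{n,m}`, computed from `d_m = s_m + d_{m+1}`: applying
`Λ_n^{s_m}` multiplies it by `‖L_n‖^{s_m}`. -/
theorem norm_smul_scaledColumn {m : ℕ} (hm : m < r) (n : ℕ) :
    ‖extendZero u m ^ Fintype.card F ^ n • scaledColumn hs u P (tailSum s (m + 1)) n m‖ =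
      ‖extendZero u m ^ Fintype.card F ^ n / carlitzL F n ^ extendZero s m‖ *
        ‖scaledColumn hs u P (tailSum s m) n m‖ := by
  have h := norm_shiftProd_pow_mulVec n (extendZero s m)
    (scaledColumn hs u P (tailSum s (m + 1)) n m)
  rw [shiftProd_pow_mulVec_scaledColumn, ← tailSum_eq_add hm] at h
  have h0 : ‖carlitzL F n‖ ≠ 0 := norm_ne_zero_iff.mpr (carlitzL_ne_zero n)
  rw [norm_smul, h, norm_div, norm_pow (carlitzL F n)]
  field_simp

theorem IsLogCoeff.exists_norm_scaledColumn_le (hP : IsLogCoeff u P)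
    (hu : ∀ i, ‖u i‖ ≤ radius F (s i)) {m : ℕ} (hm : m < r) :
    ∃ C, 0 ≤ C ∧ ∀ n, ‖scaledColumn hs u P (tailSum s m) n m‖ ≤ C := by
  induction m with
  | zero =>
    refine ⟨1, zero_le_one, fun n => ?_⟩
    rw [hP.scaledColumn_zero_right hs hm, hP.zero]
    exact norm_endColumn_one_le hs 0
  | succ m ih =>
    have hm' : m < r := by omega
    obtain ⟨C, hC0, hC⟩ := ih hm'
    refine ⟨max 1 (radius F (s ⟨m, hm'⟩) * C), le_max_of_le_left zero_le_one, fun n => ?_⟩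
    rw [hP.scaledColumn_succ_right hs n hm, hP.zero]
    rw [sub_eq_add_neg]
    refine (IsUltrametricDist.norm_add_le_max _ _).trans
      (max_le_max (norm_endColumn_one_le hs _) ?_)
    rw [norm_neg]
    refine IsUltrametricDist.norm_sum_le_of_forall_le_of_nonneg
      (mul_nonneg (radius_pos _).le hC0) fun i _ => ?_
    rw [norm_smul_scaledColumn hs hm', extendZero_of_lt u hm', extendZero_of_lt s hm']
    exact mul_le_mul (norm_pow_div_carlitzL_pow_le (hu _) i) (hC i) (norm_nonneg _)
      (radius_pos _).le

theorem mulVec_specialPoint_eq_scaledColumn {m : ℕ} (hm : m + 1 = r) (n : ℕ) :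
    P n *ᵥ (fun x => specialPoint s u x ^ Fintype.card F ^ n) =
      extendZero u m ^ Fintype.card F ^ n • scaledColumn hs u P (tailSum s (m + 1)) n m := by
  rw [mulVec_specialPoint_pow hs u (pow_ne_zero _ Fintype.card_ne_zero) (neg_one_pow_card_pow n)
    (P n) hm, scaledColumn, tailSum, hm, Finset.Ico_self, Finset.sum_empty, pow_zero,
    Matrix.one_mulVec]

theorem IsLogCoeff.summable (hs : ∀ i, 0 < s i) (hP : IsLogCoeff u P) (hu : ∀ i, ‖u i‖ ≤ radius F (s i)) {m : ℕ}
    (hm : m + 1 = r) (hlast : ‖extendZero u m‖ < radius F (extendZero s m)) :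
    Summable fun n => P n *ᵥ (fun x => specialPoint s u x ^ Fintype.card F ^ n) := by
  have hm' : m < r := by omega
  obtain ⟨C, -, hC⟩ := hP.exists_norm_scaledColumn_le hs hu hm'
  refine NonarchimedeanAddGroup.summable_of_tendsto_cofinite_zero ?_
  rw [Nat.cofinite_eq_atTop]
  have h := (tendsto_pow_div_carlitzL_pow hlast).mul_const C
  rw [zero_mul] at h
  refine squeeze_zero_norm (fun n => ?_) h
  rw [mulVec_specialPoint_eq_scaledColumn hs hm, norm_smul_scaledColumn hs hm']
  exact mul_le_mul_of_nonneg_left (hC n) (norm_nonneg _)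

variable (s u) in
/-- The terms `u_m^{q^n} / L_n^{s_m}` of the series for the Carlitz polylogarithms at the `u_m`. -/
def polylogFactor (m n : ℕ) : CInfty F :=
  extendZero u m ^ Fintype.card F ^ n / carlitzL F n ^ extendZero s m

theorem smul_scaledColumn_blockEnd {m : ℕ} (hm : m < r) (n : ℕ) (ℓ : Fin r) :
    (extendZero u m ^ Fintype.card F ^ n • scaledColumn hs u P (tailSum s (m + 1)) n m)
        (blockEnd hs ℓ) =
      polylogFactor s u m n * scaledColumn hs u P (tailSum s m) n m (blockEnd hs ℓ) := by
  have h := shiftProd_pow_mulVec_blockEnd hs n (extendZero s m)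
    (scaledColumn hs u P (tailSum s (m + 1)) n m) ℓ
  rw [shiftProd_pow_mulVec_scaledColumn, ← tailSum_eq_add hm] at h
  have h0 := carlitzL_ne_zero (F := F) n
  rw [h, Pi.smul_apply, smul_eq_mul, polylogFactor]
  field_simp

theorem endColumn_one_blockEnd (m : ℕ) (ℓ : Fin r) :
    endColumn hs (1 : Matrix (BlockIndex s) (BlockIndex s) (CInfty F)) m (blockEnd hs ℓ) =
      if m = ℓ then 1 else 0 := by
  rw [endColumn, extendZero]
  split_ifs with h1 h2 h2
  · subst h2
    exact Matrix.one_apply_eq _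
  · simp only [Matrix.one_apply]
    refine if_neg fun h => ?_
    exact h2 (congrArg (fun x : BlockIndex s => (x.1 : ℕ)) h).symm
  · omega
  · rfl

theorem IsLogCoeff.scaledColumn_blockEnd_of_lt (hP : IsLogCoeff u P) {m : ℕ} {ℓ : Fin r}
    (hm : m < ℓ) (n : ℕ) : scaledColumn hs u P (tailSum s m) n m (blockEnd hs ℓ) = 0 := by
  have hℓ := ℓ.2
  induction m generalizing n with
  | zero =>
    rw [hP.scaledColumn_zero_right hs (by omega), hP.zero, endColumn_one_blockEnd, if_neg hm.ne]
  | succ m ih =>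
    rw [hP.scaledColumn_succ_right hs n (by omega), hP.zero, Pi.sub_apply, endColumn_one_blockEnd,
      if_neg hm.ne, Finset.sum_apply, zero_sub, neg_eq_zero]
    refine Finset.sum_eq_zero fun i _ => ?_
    rw [smul_scaledColumn_blockEnd hs (by omega), ih (by omega), mul_zero]

theorem IsLogCoeff.scaledColumn_blockEnd_self (hP : IsLogCoeff u P) (ℓ : Fin r) (n : ℕ) :
    scaledColumn hs u P (tailSum s ℓ) n ℓ (blockEnd hs ℓ) = 1 := by
  obtain ⟨_ | m, hm⟩ := ℓ
  · rw [hP.scaledColumn_zero_right hs hm, hP.zero, endColumn_one_blockEnd, if_pos rfl]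
  · rw [hP.scaledColumn_succ_right hs n hm, hP.zero, Pi.sub_apply, endColumn_one_blockEnd,
      if_pos rfl, Finset.sum_apply, sub_eq_self]
    refine Finset.sum_eq_zero fun i _ => ?_
    rw [smul_scaledColumn_blockEnd hs (by omega), hP.scaledColumn_blockEnd_of_lt hs, mul_zero]
    simp

/-- The last coordinate in block `ℓ` is, up to sign, a truncated star polylogarithm. -/
theorem IsLogCoeff.scaledColumn_blockEnd (hP : IsLogCoeff u P) (ℓ : Fin r) (l : ℕ)
    (hl : ℓ + l < r) (n : ℕ) :
    scaledColumn hs u P (tailSum s (ℓ + l)) n (ℓ + l) (blockEnd hs ℓ) =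
      (-1) ^ l * nestedSum (fun j : Fin l => polylogFactor s u (ℓ + l - 1 - j)) n := by
  induction l generalizing n with
  | zero =>
    rw [nestedSum_zero, pow_zero, mul_one]
    exact hP.scaledColumn_blockEnd_self hs ℓ n
  | succ l ih =>
    have hne : (ℓ : ℕ) + l + 1 ≠ ℓ := by omega
    rw [← add_assoc, hP.scaledColumn_succ_right hs n (m := ℓ + l) hl, hP.zero, Pi.sub_apply,
      endColumn_one_blockEnd, if_neg hne, zero_sub, Finset.sum_apply, nestedSum_succ,
      Finset.mul_sum, ← Finset.sum_neg_distrib]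
    refine Finset.sum_congr rfl fun i _ => ?_
    rw [smul_scaledColumn_blockEnd hs (by omega), ih (by omega)]
    have h1 : (fun j : Fin l => polylogFactor s u (ℓ + l - 1 - j)) =
        fun j : Fin l => polylogFactor s u (ℓ + l + 1 - 1 - (j.succ : ℕ)) := by
      funext j
      congr 1
      simp only [Fin.val_succ]
      omega
    rw [h1]
    simp only [Fin.val_zero, Nat.add_sub_cancel, Nat.sub_zero, pow_succ]
    ring

theorem revTail_apply {α : Type*} [Zero α] (a : Fin r → α) (ℓ : Fin r) (j : Fin (r - ℓ)) :
    revTail a ℓ j = extendZero a (r - 1 - j) := by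
  have h : r - 1 - (j : ℕ) < r := by
    have := ℓ.2
    omega
  rw [extendZero_of_lt a h, revTail]
  congr 1
  ext
  simp only [Fin.val_rev, Fin.val_castLE]
  omega

theorem polylogTerm_revTail (ℓ : Fin r) (i : Fin (r - ℓ) → ℕ) :
    polylogTerm F (revTail s ℓ) (revTail u ℓ) i =
      ∏ j : Fin (r - ℓ), polylogFactor s u (r - 1 - j) (i j) := by
  rw [polylogTerm, ← Finset.prod_div_distrib]
  refine Finset.prod_congr rfl fun j _ => ?_
  rw [revTail_apply, revTail_apply, polylogFactor]

theorem norm_polylogFactor_le (hu : ∀ i, ‖u i‖ ≤ radius F (s i)) {m : ℕ} (hm : m < r) (n : ℕ) :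
    ‖polylogFactor s u m n‖ ≤ radius F (extendZero s m) := by
  refine norm_pow_div_carlitzL_pow_le ?_ n
  rw [extendZero_of_lt u hm, extendZero_of_lt s hm]
  exact hu _

theorem summable_prod_polylogFactor (hu : ∀ i, ‖u i‖ ≤ radius F (s i)) {m : ℕ}
    (hm : m + 1 = r) (hlast : ‖extendZero u m‖ < radius F (extendZero s m)) (l : ℕ) :
    Summable fun i : {i : Fin (l + 1) → ℕ // Antitone i} =>
      ∏ j : Fin (l + 1), polylogFactor s u (m - j) (i.1 j) :=
  summable_antitone_prod (fun j : Fin (l + 1) => polylogFactor s u (m - j)) _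
    (fun _ => norm_polylogFactor_le hu (by omega)) (tendsto_pow_div_carlitzL_pow hlast)

theorem starPolylogConverges_revTail (hu : ∀ i, ‖u i‖ ≤ radius F (s i)) {m : ℕ}
    (hm : m + 1 = r) (hlast : ‖extendZero u m‖ < radius F (extendZero s m)) (ℓ : Fin r) :
    StarPolylogConverges F (revTail s ℓ) (revTail u ℓ) := by
  obtain ⟨l, hl⟩ : ∃ l, r - (ℓ : ℕ) = l + 1 := ⟨r - ℓ - 1, by omega⟩
  rw [StarPolylogConverges]
  simp only [polylogTerm_revTail]
  have hr1 : r - 1 = m := by omega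
  rw [hl, hr1]
  exact summable_prod_polylogFactor hu hm hlast l

theorem starPolylog_revTail {m : ℕ} (hm : m + 1 = r) (ℓ : Fin r) {l : ℕ} (hl : ℓ + l = m) :
    starPolylog F (revTail s ℓ) (revTail u ℓ) =
      ∑' i : {i : Fin (l + 1) → ℕ // Antitone i}, ∏ j : Fin (l + 1), polylogFactor s u (m - j) (i.1 j) := by
  rw [starPolylog]
  simp only [polylogTerm_revTail]
  have hr1 : r - 1 = m := by omega
  have hl1 : r - (ℓ : ℕ) = l + 1 := by omega
  rw [hl1, hr1]

/-- The last coordinate of the logarithm in block `ℓ`. -/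
theorem IsLogCoeff.hasSum_blockEnd (hP : IsLogCoeff u P) (hu : ∀ i, ‖u i‖ ≤ radius F (s i))
    {m : ℕ} (hm : m + 1 = r) (hlast : ‖extendZero u m‖ < radius F (extendZero s m)) (ℓ : Fin r) :
    HasSum (fun n => (P n *ᵥ fun x => specialPoint s u x ^ Fintype.card F ^ n) (blockEnd hs ℓ))
      ((-1) ^ (r - ((ℓ : ℕ) + 1)) * starPolylog F (revTail s ℓ) (revTail u ℓ)) := by
  obtain ⟨l, hl⟩ : ∃ l, (ℓ : ℕ) + l = m := ⟨m - ℓ, by omega⟩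
  have hexp : r - ((ℓ : ℕ) + 1) = l := by omega
  rw [starPolylog_revTail hm ℓ hl, hexp]
  refine HasSum.congr_fun ((hasSum_mul_nestedSum (fun j : Fin (l + 1) => polylogFactor s u (m - j))
    (summable_prod_polylogFactor hu hm hlast l)).mul_left ((-1) ^ l)) fun n => ?_
  have h := hP.scaledColumn_blockEnd hs ℓ l (by omega) n
  have h1 : (fun j : Fin l => polylogFactor s u (m - 1 - j)) =
      fun j : Fin l => polylogFactor s u (m - (j.succ : ℕ)) := by
    funext j
    congr 1
    simp only [Fin.val_succ]
    omega
  rw [hl, h1] at h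
  rw [mulVec_specialPoint_eq_scaledColumn hs hm, smul_scaledColumn_blockEnd hs (by omega), h]
  simp only [Fin.val_zero, Nat.sub_zero]
  ring

/-- The coefficients of the logarithm of the `t`-module satisfy the relations, after base change
from `k̄` to `ℂ_∞`. -/
theorem isLogCoeff_log (u : Fin r → KBar F) :
    IsLogCoeff (s := s) (fun i => (u i : CInfty F))
      fun n => ((tModule F s u).log.coeff n).map (algebraMap (KBar F) (CInfty F)) where
  zero := by
    rw [TModule.log_coeff_zero]
    exact Matrix.map_one _ (map_zero _) (map_one _)
  succ n := by
    have h := congrArg (fun A => A.map (algebraMap (KBar F) (CInfty F)))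
      (shiftMatrix_mul_log_coeff (F := F) s u n)
    simp only [Matrix.map_mul, Matrix.map_add _ (map_add (algebraMap (KBar F) (CInfty F))),
      map_shiftMatrix, map_matN] at h
    have hθ : algebraMap (KBar F) (CInfty F) (theta F (KBar F)) = theta F (CInfty F) := rfl
    have hE : ((matE s u).map (· ^ Fintype.card F ^ n)).map (algebraMap (KBar F) (CInfty F)) =
        (matE s fun i => (u i : CInfty F)).map (· ^ Fintype.card F ^ n) := by
      have h1 := map_matE (algebraMap (KBar F) (CInfty F)) s u
      ext x y
      have h2 := congrFun (congrFun h1 x) y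
      simp only [Matrix.map_apply, map_pow] at h2 ⊢
      rw [h2]
      rfl
    rw [hE, map_sub, map_pow, hθ] at h
    exact h

end Main

end CarlitzStar

end

open CarlitzStar in
theorem theorem4p2p3 {F : Type*} [Field F] [Fintype F] {r : ℕ} (hr : 0 < r)
    (s : Fin r → ℕ) (hs : ∀ i, 0 < s i)
    (u : Fin r → KBar F) (hu : ∀ i, u i ≠ 0)
    (hD : (fun i => (u (Fin.rev i) : CInfty F)) ∈ polylogDomain F (fun i => s (Fin.rev i))) :
    ∃ Z : BlockIndex s → CInfty F,
      HasSum ((tModule F s u).logTerm fun x => ((specialPoint s u x : KBar F) : CInfty F)) Z ∧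
      (∀ x : BlockIndex s, IsBlockEnd x →
        StarPolylogConverges F (revTail s x.1) (revTail (fun i => (u i : CInfty F)) x.1) ∧
        Z x = (-1) ^ (r - ((x.1 : ℕ) + 1)) *
          starPolylog F (revTail s x.1) (revTail (fun i => (u i : CInfty F)) x.1)) ∧
      (∃ x : BlockIndex s, position x = ∑ i, s i ∧
        Z x = (-1) ^ (r - 1) *
          starPolylog F (fun i => s (Fin.rev i)) (fun i => (u (Fin.rev i) : CInfty F))) := by
  obtain ⟨m, hm⟩ : ∃ m, m + 1 = r := ⟨r - 1, by omega⟩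
  have hm' : m < r := by omega
  set v : Fin r → CInfty F := fun i => (u i : CInfty F) with hv
  have hlt : ‖extendZero v m‖ < radius F (extendZero s m) := by
    rw [extendZero_of_lt v hm', extendZero_of_lt s hm']
    have hrev : Fin.rev (⟨0, hr⟩ : Fin r) = ⟨m, hm'⟩ := by
      ext
      simp only [Fin.val_rev]
      omega
    have h := (hD ⟨0, hr⟩).1 rfl
    simp only [hrev] at h
    exact h
  have hle (i : Fin r) : ‖v i‖ ≤ radius F (s i) := by
    have h := hD (Fin.rev i)
    simp only [Fin.rev_rev] at h
    by_cases hi : ((Fin.rev i : Fin r) : ℕ) = 0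
    · exact (h.1 hi).le
    · exact h.2 hi
  have hP := isLogCoeff_log (s := s) u
  have hterm : (tModule F s u).logTerm (fun x => ((specialPoint s u x : KBar F) : CInfty F)) =
      fun n => (((tModule F s u).log.coeff n).map (algebraMap (KBar F) (CInfty F))).mulVec
        fun x => specialPoint s v x ^ Fintype.card F ^ n := by
    funext n
    rw [TModule.logTerm]
    congr 1
    funext x
    congr 1
    exact map_specialPoint (algebraMap (KBar F) (CInfty F)) s u x
  obtain ⟨Z, hZ⟩ := hP.summable hs hle hm hlt
  have hval (ℓ : Fin r) : Z (blockEnd hs ℓ) =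
      (-1) ^ (r - ((ℓ : ℕ) + 1)) * starPolylog F (revTail s ℓ) (revTail v ℓ) :=
    (Pi.hasSum.mp hZ _).unique (hP.hasSum_blockEnd hs hle hm hlt ℓ)
  refine ⟨Z, hterm ▸ hZ, fun x hx =>
    ⟨starPolylogConverges_revTail hle hm hlt x.1, ?_⟩, blockEnd hs ⟨0, hr⟩, ?_, hval ⟨0, hr⟩⟩
  · have h := hval x.1
    rwa [← hx.eq_blockEnd hs] at h
  · have hsize : blockSize s ⟨0, hr⟩ = ∑ i, s i := by
      rw [blockSize]
      congr 1
      ext i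
      simp [Fin.le_def]
    rw [position, finSigmaFinEquiv_apply, ← hsize]
    change ∑ i : Fin 0, _ + (blockSize s ⟨0, hr⟩ - 1) + 1 = _
    rw [Finset.univ_eq_empty, Finset.sum_empty, zero_add,
      Nat.sub_one_add_one (blockSize_pos hs _).ne']
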